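/- **Theorem.** Let $\mathcal{G}$ be a gerbe on a topological space $X$, i.e. a stack of groupoids on $X$ such that every point has an open neighbourhood $U$ with $\mathcal{G}(U)$ nonempty, and such that any two objects of $\mathcal{G}(U)$ are isomorphic locally on $U$. For $i,j\in\mathcal{G}(U)$ denote by $\mathcal{G}(i,j)$ the sheaf on $U$ of isomorphisms $i\to j$. A normal subgroupoid $\mathcal{N}$ of $\mathcal{G}$ is a collection of subsheaves of groups $\mathcal{N}(i,i)\subset\mathcal{G}(i,i)$, one for each local object $i$ of $\mathcal{G}$ (compatible with restriction of objects), such that $g\,\mathcal{N}(i,i)\,g^{-1}=\mathcal{N}(j,j)$ for every local isomorphism $g:i\to j$. Let $\{\mathcal{N}_p\}_{p\in\mathbb{N}}$ be a central filtration of $\mathcal{G}$: a descending sequence of normal subgroupoids such that for every local object $i$ one has $\mathcal{N}_0(i,i)=\mathcal{G}(i,i)$, $\bigcap_p\mathcal{N}_p(i,i)=1$, and for every $p$ the subsheaf $\mathcal{N}_p(i,i)/\mathcal{N}_{p+1}(i,i)$ is central in $\mathcal{G}(i,i)/\mathcal{N}_{p+1}(i,i)$. By centrality, conjugation by local isomorphisms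 glues the sheaves $\mathcal{N}_p(i,i)/\mathcal{N}_{p+1}(i,i)$ canonically to a sheaf of abelian groups $\mathcal{N}_p/\mathcal{N}_{p+1}$ on $X$, whose restriction to the domain of $i$ is $\mathcal{N}_p(i,i)/\mathcal{N}_{p+1}(i,i)$. Assume that $\mathcal{G}$ is complete with respect to the filtration, i.e. that for every local object $i$ the canonical homomorphism of sheaves of groups $\mathcal{G}(i,i)\to\varprojlim_p\mathcal{G}(i,i)/\mathcal{N}_p(i,i)$ is an isomorphism. Call an open set $V\subset X$ acyclic if $\mathcal{G}(V)$ is nonempty and for every $i\in\mathcal{G}(V)$: (a) the sheaf cohomology $\mathrm{H}^k(V,\mathcal{N}_p(i,i)/\mathcal{N}_{p+1}(i,i))$ is trivial for all $p\ge 0$ and $k>0$; (b) for all $q\ge p\ge 0$ the homomorphism $\Gamma(V,\mathcal{N}_p(i,i))\to\Gamma(V,\mathcal{N}_p(i,i)/\mathcal{N}_q(i,i))$ is surjective. Assume that there are enough acyclic coverings: every open covering of an open set of $X$ has a refinement, again an open covering of that set, all of whose nonempty finite families of members have acyclic intersection. Let $U$ be an open set of $X$. 1. If $\mathrm{H}^1(U,\mathcal{N}_p/\mathcal{N}_{p+1})=1$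 for every $p\ge 0$, then the groupoid $\mathcal{G}(U)$ is connected, i.e. any two objects of $\mathcal{G}(U)$ are isomorphic. 2. If $\mathrm{H}^2(U,\mathcal{N}_p/\mathcal{N}_{p+1})=1$ for every $p\ge 0$, then $\mathcal{G}(U)$ is nonempty. -/

import Mathlib

open CategoryTheory TopologicalSpace Opposite

universe u w

namespace PronilpotentGerbe

open Pseudofunctor.LocallyDiscreteOpToCat

noncomputable section

/-- A prestack on the topological space `X`: a pseudofunctor from the opposite of the category of
open sets of `X` to the bicategory of categories. No gluing condition is imposed. -/
abbrev PrestackOn (X : TopCat.{u}) := Pseudofunctor (LocallyDiscrete (Opens X)ᵒᵖ) Cat.{u, w}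

section Prestack

variable {X : TopCat.{u}} (G : PrestackOn.{u, w} X)

/-- The category `G(U)` of local objects over the open set `U`. -/
abbrev Sec (U : Opens X) : Type w := G.obj (.mk (op U))

variable {G}

/-- The restriction `i|_V` of a local object `i` over `U` along `V ⊆ U`. -/
abbrev res {U V : Opens X} (f : V ⟶ U) (i : Sec G U) : Sec G V :=
  (G.map f.op.toLoc).toFunctor.obj i

/-- The restriction homomorphism `Aut(i) → Aut(i|_V)`. -/
def resAut {U V : Opens X} (f : V ⟶ U) (i : Sec G U) : Aut i →* Aut (res f i) :=
  (G.map f.op.toLoc).toFunctor.mapAut i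

/-- The restriction homomorphism `Aut(i|_V) → Aut(i|_W)` of the presheaf of groups `G(i, i)`, for
`W ⊆ V ⊆ U`: apply the restriction functor, then transport along the composition isomorphism
`(i|_V)|_W ≅ i|_W`. -/
def pullAut {U V W : Opens X} (f : V ⟶ U) (g : W ⟶ V) (h : W ⟶ U) (i : Sec G U) :
    Aut (res f i) →* Aut (res h i) :=
  (((Cat.Hom.toNatIso
    (G.mapComp' f.op.toLoc g.op.toLoc h.op.toLoc (by cat_disch))).app i).symm.conjAut
      |>.toMonoidHom).comp (resAut g (res f i))

lemma pullAut_hom {U V W : Opens X} (f : V ⟶ U) (g : W ⟶ V) (h : W ⟶ U) (i : Sec G U)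
    (a : Aut (res f i)) :
    (pullAut f g h i a).hom = pullHom (M₁ := i) (M₂ := i) a.hom g h h := by
  simp [pullAut, resAut, pullHom, Functor.mapAut, Iso.conj_apply]
  rfl

lemma pullAut_id {U V : Opens X} (f : V ⟶ U) (g : V ⟶ V) (i : Sec G U)
    (a : Aut (res f i)) : pullAut f g f i a = a := by
  obtain rfl : g = 𝟙 V := Subsingleton.elim _ _
  ext
  rw [pullAut_hom]
  exact pullHom_id a.hom

lemma pullAut_pullAut {U V W W' : Opens X} (f : V ⟶ U) (g : W ⟶ V) (h : W ⟶ U)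
    (g' : W' ⟶ W) (gg : W' ⟶ V) (h' : W' ⟶ U) (i : Sec G U) (a : Aut (res f i)) :
    pullAut h g' h' i (pullAut f g h i a) = pullAut f gg h' i a := by
  obtain rfl : gg = g' ≫ g := Subsingleton.elim _ _
  ext
  rw [pullAut_hom, pullAut_hom, pullAut_hom]
  exact pullHom_pullHom a.hom g h h g' h' h'

end Prestack

/-- A gerbe on `X`: a stack of groupoids which is locally nonempty and locally connected. -/
class IsGerbe {X : TopCat.{u}} (G : PrestackOn.{u, w} X) : Prop
    extends G.IsStack (Opens.grothendieckTopology X) where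
  isGroupoid (U : Opens X) : IsGroupoid (Sec G U)
  locally_nonempty (x : X) : ∃ U : Opens X, x ∈ U ∧ Nonempty (Sec G U)
  locally_connected (U : Opens X) (i j : Sec G U) (x : X) (hx : x ∈ U) :
    ∃ (V : Opens X) (f : V ⟶ U), x ∈ V ∧ Nonempty (res f i ⟶ res f j)

/-- A normal subgroupoid of `G`: for every local object `i` a subsheaf of groups
`N(i, i) ⊆ G(i, i)`, such that `Ad(g)` maps `N(i, i)` onto `N(j, j)` for every local isomorphism
`g : i ≅ j`. Here `grp i` is the group of sections of `N(i, i)` over the open set on which `i` is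
defined; the sections over a smaller open set `V` are `grp (i|_V)`. -/
structure NormalSubgroupoid {X : TopCat.{u}} (G : PrestackOn.{u, w} X) where
  grp {U : Opens X} (i : Sec G U) : Subgroup (Aut i)
  conj_mem {U : Opens X} {i j : Sec G U} (g : i ≅ j) (n : Aut i) (hn : n ∈ grp i) :
    g.conjAut n ∈ grp j
  res_mem {U V : Opens X} (f : V ⟶ U) (i : Sec G U) (n : Aut i) (hn : n ∈ grp i) :
    resAut f i n ∈ grp (res f i)
  local_mem {U : Opens X} (i : Sec G U) (n : Aut i)
    (hn : ∀ x ∈ U, ∃ (V : Opens X) (f : V ⟶ U), x ∈ V ∧ resAut f i n ∈ grp (res f i)) :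
    n ∈ grp i

namespace NormalSubgroupoid

variable {X : TopCat.{u}} {G : PrestackOn.{u, w} X}

instance (N : NormalSubgroupoid G) {U : Opens X} (i : Sec G U) : (N.grp i).Normal where
  conj_mem n hn g := by
    have h := N.conj_mem (i := i) (j := i) g n hn
    have e : g * n * g⁻¹ = Iso.conjAut (X := i) (Y := i) g n := (Iso.conjAut_apply _ _).symm
    rw [e]
    exact h

lemma pull_mem (N : NormalSubgroupoid G) {U V W : Opens X} (f : V ⟶ U) (g : W ⟶ V) (h : W ⟶ U)
    (i : Sec G U) (n : Aut (res f i)) (hn : n ∈ N.grp (res f i)) :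
    pullAut f g h i n ∈ N.grp (res h i) :=
  N.conj_mem _ _ (N.res_mem g (res f i) n hn)

/-- The normal subgroupoid consisting of all the automorphism groups. -/
def whole (G : PrestackOn.{u, w} X) : NormalSubgroupoid G where
  grp _ := ⊤
  conj_mem _ _ _ := trivial
  res_mem _ _ _ _ := trivial
  local_mem _ _ _ := trivial

lemma conjAut_symm_conjAut {C : Type*} [Category C] {a b : C} (c : a ≅ b) (f : Aut a) :
    c.symm.conjAut (c.conjAut f) = f := by
  ext
  simp [Iso.conj_apply]

/-- Restriction `M(i, i)(V) → M(i, i)(W)`. -/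
def pull (M : NormalSubgroupoid G) {U V W : Opens X} (f : V ⟶ U) (g : W ⟶ V) (h : W ⟶ U)
    (i : Sec G U) : M.grp (res f i) →* M.grp (res h i) :=
  ((pullAut f g h i).comp (M.grp (res f i)).subtype).codRestrict _
    fun n => M.pull_mem f g h i n n.2

/-! ### The quotient sheaf `M(i, i) / N(i, i)` of a single local object -/

variable (M N : NormalSubgroupoid G)

/-- For `N ⊆ M` and a local object `i` over `U`, the presheaf `V ↦ M(i, i)(V) / N(i, i)(V)` on
the open subsets of `U`. -/
def quotPresheaf {U : Opens X} (i : Sec G U) : (Over U)ᵒᵖ ⥤ Type u where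
  obj T := M.grp (res T.unop.hom i) ⧸ (N.grp (res T.unop.hom i)).subgroupOf _
  map {T T'} f := ↾(QuotientGroup.map ((N.grp (res T.unop.hom i)).subgroupOf _)
    ((N.grp (res T'.unop.hom i)).subgroupOf _) (M.pull T.unop.hom f.unop.left T'.unop.hom i)
    fun n hn => N.pull_mem _ f.unop.left _ i n.1 hn)
  map_id T := by
    ext a
    induction a using QuotientGroup.induction_on with
    | H a => exact congrArg _ (Subtype.ext (pullAut_id _ _ i a.1))
  map_comp {T T' T''} f g := by
    ext a
    induction a using QuotientGroup.induction_on with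
    | H a => exact congrArg _ (Subtype.ext (pullAut_pullAut _ _ _ _ _ _ i a.1).symm)

/-- The quotient sheaf `M(i, i) / N(i, i)` on `U` (as a sheaf of sets). -/
def quotSheaf {U : Opens X} (i : Sec G U) : Sheaf ((Opens.grothendieckTopology X).over U) (Type u) :=
  (presheafToSheaf _ _).obj (quotPresheaf M N i)

/-- The canonical map `M(i, i)(T) → Γ(T, M(i, i) / N(i, i))`, for `T ⊆ U`. -/
def toQuot {U : Opens X} (i : Sec G U) (T : Over U) (n : M.grp (res T.hom i)) :
    (quotSheaf M N i).obj.obj (op T) :=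
  (toSheafify ((Opens.grothendieckTopology X).over U) (quotPresheaf M N i)).app (op T)
    (QuotientGroup.mk n)

variable {N} in
/-- The canonical morphism of sheaves `M(i, i) / N'(i, i) → M(i, i) / N(i, i)` for `N' ⊆ N`. -/
def quotSheafMap {N' : NormalSubgroupoid G}
    (h : ∀ {U : Opens X} (i : Sec G U), N'.grp i ≤ N.grp i) {U : Opens X} (i : Sec G U) :
    quotSheaf M N' i ⟶ quotSheaf M N i :=
  (presheafToSheaf _ _).map
    { app T := ↾(QuotientGroup.map _ _ (MonoidHom.id (M.grp (res T.unop.hom i)))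
        fun _ hn => h _ hn)
      naturality {T T'} f := by
        ext a
        induction a using QuotientGroup.induction_on with
        | H a => rfl }

/-! ### The sheaf of abelian groups `M / N` on `X` -/

section Band

variable [IsGerbe G]

variable (G) in
/-- An open neighbourhood of `x` over which the gerbe has an object. -/
def chartDom (x : X) : Opens X := (IsGerbe.locally_nonempty (G := G) x).choose

variable (G) in
lemma mem_chartDom (x : X) : x ∈ chartDom G x :=
  (IsGerbe.locally_nonempty (G := G) x).choose_spec.1

variable (G) in
/-- A local object of the gerbe near `x`. -/
def chart (x : X) : Sec G (chartDom G x) :=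
  (IsGerbe.locally_nonempty (G := G) x).choose_spec.2.some

variable (G) in
/-- The charts that are defined on all of `V`. -/
abbrev ChartOn (V : Opens X) := {x : X // V ≤ chartDom G x}

/-- The local object over `V` given by a chart. -/
abbrev ChartOn.obj {V : Opens X} (x : ChartOn G V) : Sec G V :=
  res (homOfLE x.2) (chart G x.1)

/-- The restriction of a chart to a smaller open set. -/
abbrev ChartOn.restrict {V W : Opens X} (f : W ⟶ V) (x : ChartOn G V) : ChartOn G W :=
  ⟨x.1, f.le.trans x.2⟩

/-- The restriction `M(i, i)(V) → M(i, i)(W)` for a chart object `i`. -/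
def chartPull {V W : Opens X} (f : W ⟶ V) (x : ChartOn G V) :
    M.grp x.obj →* M.grp (x.restrict f).obj :=
  M.pull (homOfLE x.2) f (homOfLE (f.le.trans x.2)) (chart G x.1)

/-- Transport `Ad(g) : M(i, i) → M(j, j)`. -/
def Ad {V : Opens X} {i j : Sec G V} (g : i ≅ j) : M.grp i →* M.grp j :=
  (g.conjAut.toMonoidHom.comp (M.grp i).subtype).codRestrict _ fun n => M.conj_mem g n n.2

/-- Generators of the group of sections over `V`: a local object `i` over `V` (in a chart) and a
section of `M(i, i)` over `V`. -/
abbrev BandGen (V : Opens X) := Σ x : ChartOn G V, M.grp x.obj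

/-- The relations between the generators: the group law of each `M(i, i)`, the vanishing of
`N(i, i)`, and the identification of `n` with `Ad(g)(n)` for every isomorphism `g : i ≅ j`. -/
inductive BandRel (V : Opens X) : FreeAbelianGroup (BandGen M V) → Prop
  | mul (x : ChartOn G V) (a b : M.grp x.obj) :
      BandRel V (.of ⟨x, a * b⟩ - .of ⟨x, a⟩ - .of ⟨x, b⟩)
  | kill (x : ChartOn G V) (a : M.grp x.obj) (ha : (a : Aut x.obj) ∈ N.grp x.obj) :
      BandRel V (.of ⟨x, a⟩)
  | ad (x y : ChartOn G V) (g : x.obj ≅ y.obj) (a : M.grp x.obj) :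
      BandRel V (.of ⟨x, a⟩ - .of ⟨y, M.Ad g a⟩)

/-- The subgroup generated by the relations. -/
def bandRelations (V : Opens X) : AddSubgroup (FreeAbelianGroup (BandGen M V)) :=
  AddSubgroup.closure {z | BandRel M N V z}

/-- Restriction of generators. -/
def BandGen.restrict {V W : Opens X} (f : W ⟶ V) (s : BandGen M V) : BandGen M W :=
  ⟨s.1.restrict f, M.chartPull f s.1 s.2⟩

lemma chartPull_Ad {V W : Opens X} (f : W ⟶ V) (x y : ChartOn G V) (g : x.obj ≅ y.obj)
    (a : M.grp x.obj) :
    ∃ g' : (x.restrict f).obj ≅ (y.restrict f).obj,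
      M.chartPull f y (M.Ad g a) = M.Ad g' (M.chartPull f x a) := by
  let c (z : ChartOn G V) := ((Cat.Hom.toNatIso (G.mapComp' (homOfLE z.2).op.toLoc f.op.toLoc
    (homOfLE (f.le.trans z.2)).op.toLoc (by cat_disch))).app (chart G z.1)).symm
  refine ⟨(c x).symm ≪≫ (G.map f.op.toLoc).toFunctor.mapIso g ≪≫ c y, Subtype.ext ?_⟩
  change (c y).conjAut ((G.map f.op.toLoc).toFunctor.mapIso (g.conjAut a.1)) =
    Iso.conjAut _ ((c x).conjAut ((G.map f.op.toLoc).toFunctor.mapIso a.1))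
  rw [Functor.map_conjAut, Iso.trans_conjAut, Iso.trans_conjAut]
  refine congrArg (fun t => (c y).conjAut (Iso.conjAut _ t)) ?_
  exact (conjAut_symm_conjAut (c x) _).symm

lemma bandRel_restrict {V W : Opens X} (f : W ⟶ V) (z : FreeAbelianGroup (BandGen M V))
    (hz : BandRel M N V z) : BandRel M N W (FreeAbelianGroup.map (BandGen.restrict M f) z) := by
  cases hz with
  | mul x a b =>
    simpa [BandGen.restrict] using
      BandRel.mul (N := N) (x.restrict f) (M.chartPull f x a) (M.chartPull f x b)
  | kill x a ha =>
    simpa [BandGen.restrict] using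
      BandRel.kill (N := N) (x.restrict f) (M.chartPull f x a) (N.pull_mem _ f _ _ a.1 ha)
  | ad x y g a =>
    obtain ⟨g', hg'⟩ := chartPull_Ad M f x y g a
    simpa [BandGen.restrict, hg'] using
      BandRel.ad (N := N) (x.restrict f) (y.restrict f) g' (M.chartPull f x a)

lemma bandRelations_le {V W : Opens X} (f : W ⟶ V) :
    bandRelations M N V ≤
      (bandRelations M N W).comap (FreeAbelianGroup.map (BandGen.restrict M f)) :=
  (AddSubgroup.closure_le _).2 fun z hz =>
    AddSubgroup.subset_closure (bandRel_restrict M N f z hz)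

lemma restrict_id {V : Opens X} (f : V ⟶ V) (s : BandGen M V) : BandGen.restrict M f s = s := by
  obtain ⟨x, a⟩ := s
  exact Sigma.ext rfl (heq_of_eq (Subtype.ext (pullAut_id _ _ _ a.1)))

lemma restrict_restrict {V W W' : Opens X} (f : W ⟶ V) (g : W' ⟶ W) (h : W' ⟶ V)
    (s : BandGen M V) :
    BandGen.restrict M g (BandGen.restrict M f s) = BandGen.restrict M h s := by
  obtain ⟨x, a⟩ := s
  exact Sigma.ext rfl (heq_of_eq (Subtype.ext (pullAut_pullAut _ _ _ _ _ _ _ a.1)))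

/-- The presheaf of abelian groups on `X` whose group of sections over `V` is the colimit of the
abelian groups `M(i, i)(V) / N(i, i)(V)`, over the groupoid of all chart objects `i` defined over
`V` and all isomorphisms between them. -/
def bandPresheaf : (Opens X)ᵒᵖ ⥤ AddCommGrpCat.{u} where
  obj V := .of (FreeAbelianGroup (BandGen M V.unop) ⧸ bandRelations M N V.unop)
  map f := AddCommGrpCat.ofHom (QuotientAddGroup.map _ _
    (FreeAbelianGroup.map (BandGen.restrict M f.unop)) (bandRelations_le M N f.unop))
  map_id V := by
    ext s
    exact congrArg (fun t => QuotientAddGroup.mk (FreeAbelianGroup.of t)) (restrict_id M _ s)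
  map_comp f g := by
    ext s
    exact congrArg (fun t => QuotientAddGroup.mk (FreeAbelianGroup.of t))
      (restrict_restrict M f.unop g.unop _ s).symm

/-- The sheaf of abelian groups `M / N` on `X`, for normal subgroupoids `N ⊆ M` of a gerbe such
that `M / N` is central in `G / N`: the sheaf associated with `bandPresheaf`. By centrality
`Ad(g)` acts on `M(i, i) / N(i, i)` independently of `g`, so that the sheaves of abelian groups
`M(i, i) / N(i, i)` of the local objects `i` are glued along the `Ad(g)` to a single sheaf on `X`,
whose restriction to the domain of `i` is `M(i, i) / N(i, i)`. Since `G` is locally connected, it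
does not depend on the choice of the charts, up to a canonical isomorphism. -/
def band : Sheaf (Opens.grothendieckTopology X) AddCommGrpCat.{u} :=
  (presheafToSheaf _ _).obj (bandPresheaf M N)

end Band

end NormalSubgroupoid

section Filtration

variable {X : TopCat.{u}} {G : PrestackOn.{u, w} X}

/-- A normal filtration of `G`: a descending sequence of normal subgroupoids. -/
def IsNormalFiltration (N : ℕ → NormalSubgroupoid G) : Prop :=
  ∀ (p : ℕ) {U : Opens X} (i : Sec G U), (N (p + 1)).grp i ≤ (N p).grp i

/-- A central filtration of `G`: a normal filtration such that for every local object `i` one has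
`N₀(i, i) = G(i, i)`, `⋂ₚ Nₚ(i, i) = 1`, and `Nₚ(i, i) / Nₚ₊₁(i, i)` is central in
`G(i, i) / Nₚ₊₁(i, i)`. As `i` runs over the local objects on all open sets, it suffices to speak
of the groups of sections on the domain of `i`. Centrality at the level of the presheaf quotients
is the same as centrality for the sheaf quotients, since `Nₚ₊₁(i, i)` is a subsheaf. -/
structure IsCentralFiltration (N : ℕ → NormalSubgroupoid G) : Prop where
  normal : IsNormalFiltration N
  zero {U : Opens X} (i : Sec G U) : (N 0).grp i = ⊤
  iInf {U : Opens X} (i : Sec G U) : ⨅ p, (N p).grp i = ⊥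
  central (p : ℕ) {U : Opens X} (i : Sec G U) :
    ((N p).grp i).map (QuotientGroup.mk' ((N (p + 1)).grp i)) ≤
      Subgroup.center (Aut i ⧸ (N (p + 1)).grp i)

/-- `G` is complete with respect to the normal filtration `N`: for every local object `i`, the
canonical morphism of sheaves `G(i, i) → limₚ G(i, i) / Nₚ(i, i)` is an isomorphism, i.e. bijective
on sections over every open subset `T` of the domain of `i`. -/
def IsComplete (N : ℕ → NormalSubgroupoid G) (hN : IsNormalFiltration N) : Prop :=
  ∀ {U : Opens X} (i : Sec G U) (T : Over U)
    (s : ∀ p, ((NormalSubgroupoid.whole G).quotSheaf (N p) i).obj.obj (op T)),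
    (∀ p, ((NormalSubgroupoid.whole G).quotSheafMap (hN p) i).hom.app (op T) (s (p + 1)) = s p) →
      ∃! g : Aut (res T.hom i), ∀ p, (NormalSubgroupoid.whole G).toQuot (N p) i T ⟨g, trivial⟩ = s p

variable [IsGerbe G]

/-- The sheaf of abelian groups `Nₚ / Nₚ₊₁` on `X`. -/
abbrev gr (N : ℕ → NormalSubgroupoid G) (p : ℕ) :
    Sheaf (Opens.grothendieckTopology X) AddCommGrpCat.{u} :=
  (N p).band (N (p + 1))

/-- The open set `U` is acyclic with respect to the central filtration `N`: the groupoid `G(U)` is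
nonempty and, for every `i ∈ G(U)`, the cohomology `Hᵏ(U, Nₚ(i, i) / Nₚ₊₁(i, i))` vanishes for
`k > 0` (here `Nₚ(i, i) / Nₚ₊₁(i, i)` is the restriction of `Nₚ / Nₚ₊₁` to `U`), and
`Γ(U, Nₚ(i, i)) → Γ(U, Nₚ(i, i) / N_q(i, i))` is surjective for `q ≥ p`. -/
structure IsAcyclicOpen (N : ℕ → NormalSubgroupoid G) (U : Opens X) : Prop where
  nonempty : Nonempty (Sec G U)
  cohomology (p k : ℕ) (hk : 0 < k) : Subsingleton (Sheaf.H'.{u} (gr N p) k U)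
  surjective (i : Sec G U) (p q : ℕ) (hpq : p ≤ q) :
    Function.Surjective ((N p).toQuot (N q) i (Over.mk (𝟙 U)))

/-- A family of open sets is acyclic if all its finite (nonempty) intersections are. -/
def IsAcyclicFamily (N : ℕ → NormalSubgroupoid G) {K : Type u} (V : K → Opens X) : Prop :=
  ∀ (m : ℕ) (k : Fin (m + 1) → K), IsAcyclicOpen N (Finset.univ.inf fun a => V (k a))

/-- Every open covering of every open set has an acyclic refinement. -/
def HasEnoughAcyclicCoverings (N : ℕ → NormalSubgroupoid G) : Prop :=
  ∀ (U : Opens X) (K : Type u) (V : K → Opens X), ⨆ k, V k = U →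
    ∃ (K' : Type u) (V' : K' → Opens X), ⨆ k', V' k' = U ∧ (∀ k', ∃ k, V' k' ≤ V k) ∧
      IsAcyclicFamily N V'

end Filtration

end

end PronilpotentGerbe

/-! Both statements are obstruction theory along the filtration, followed by passage to the limit.
Suppose that local isomorphisms `i → j` agree on overlaps modulo `N p`, or that isomorphisms `i k →
i l` of local objects satisfy the cocycle condition modulo `N p`. The error then lies in `N p`, and
its class modulo `N (p + 1)` is a Čech 1-cocycle, respectively 2-cocycle, of the abelian sheaf `gr N
p`. Vanishing of the cohomology makes it a coboundary; on acyclic open sets the bounding cochain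
lifts to actual automorphisms in `N p`, and composing with them removes the error modulo `N (p +
1)`. The corrections at stage `p` lie in `N p`, so by completeness the successive data converge; the
limit satisfies the condition modulo every `N p`, hence exactly, and the stack property glues. For
the second statement, the initial isomorphisms on double overlaps come from the first statement
applied to these overlaps.

The correction steps are `exists_correction_one` and `exists_correction_two`, the limit is
`exists_limit`. The passage from Ext groups to cocycles is `isOneCoboundary_of_subsingleton` and
`isTwoCoboundary_of_subsingleton`. The dictionary between automorphisms and sections of the band is
`autClass`: its kernel is `N` by `autClass_eq_zero_iff`, and it is onto by `exists_autClass_eq`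
where sections lift. -/

namespace PronilpotentGerbe

open Pseudofunctor.LocallyDiscreteOpToCat

noncomputable section

/-! ### Sections of abelian sheaves -/

section Sections

variable {X : TopCat.{u}}

/-- Restriction of sections of a presheaf of abelian groups. -/
def rst (F : (Opens X)ᵒᵖ ⥤ AddCommGrpCat.{u}) {V W : Opens X} (h : W ≤ V) :
    F.obj (op V) →+ F.obj (op W) :=
  (F.map (homOfLE h).op).hom

@[simp]
lemma rst_self (F : (Opens X)ᵒᵖ ⥤ AddCommGrpCat.{u}) {V : Opens X} (h : V ≤ V)
    (s : F.obj (op V)) : rst F h s = s := by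
  change (F.map (𝟙 (op V))).hom s = s
  simp

@[simp]
lemma rst_rst (F : (Opens X)ᵒᵖ ⥤ AddCommGrpCat.{u}) {V W W' : Opens X} (h : W ≤ V) (h' : W' ≤ W)
    (s : F.obj (op V)) : rst F h' (rst F h s) = rst F (h'.trans h) s := by
  change _ = (F.map ((homOfLE h).op ≫ (homOfLE h').op)).hom s
  rw [Functor.map_comp]
  rfl

lemma rst_app {F F' : (Opens X)ᵒᵖ ⥤ AddCommGrpCat.{u}} (φ : F ⟶ F') {V W : Opens X} (h : W ≤ V)
    (s : F.obj (op V)) : (φ.app (op W)).hom (rst F h s) = rst F' h ((φ.app (op V)).hom s) :=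
  ConcreteCategory.congr_hom (φ.naturality (homOfLE h).op) s

variable (F : Sheaf (Opens.grothendieckTopology X) AddCommGrpCat.{u})

lemma eq_of_rst_eq {V : Opens X} (s t : F.obj.obj (op V))
    (h : ∀ x ∈ V, ∃ (W : Opens X) (hW : W ≤ V), x ∈ W ∧ rst F.obj hW s = rst F.obj hW t) :
    s = t := by
  choose W hW hx e using h
  exact TopCat.Sheaf.eq_of_locally_eq' (C := AddCommGrpCat.{u}) F
    (fun x : V => W x.1 x.2) V (fun x => homOfLE (hW x.1 x.2))
    (fun x hxV => Opens.mem_iSup.2 ⟨⟨x, hxV⟩, hx x hxV⟩) s t (fun x => e x.1 x.2)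

lemma exists_rst_eq {ι : Type*} (V : ι → Opens X) (U : Opens X) (hV : ∀ i, V i ≤ U)
    (hU : U ≤ iSup V) (s : ∀ i, F.obj.obj (op (V i)))
    (hs : ∀ i j, rst F.obj inf_le_left (s i) = rst F.obj (inf_le_right : V i ⊓ V j ≤ V j) (s j)) :
    ∃ t : F.obj.obj (op U), ∀ i, rst F.obj (hV i) t = s i :=
  (TopCat.Sheaf.existsUnique_gluing' (C := AddCommGrpCat.{u}) F V U
    (fun i => homOfLE (hV i)) hU s hs).exists

end Sections

/-! ### Čech cocycles in degrees one and two -/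

section Cech

variable {X : TopCat.{u}}

/-- A Čech 1-cocycle of the presheaf `F` for the family `V`. -/
def IsOneCocycle (F : (Opens X)ᵒᵖ ⥤ AddCommGrpCat.{u}) {K : Type*} (V : K → Opens X)
    (c : ∀ k l, F.obj (op (V k ⊓ V l))) : Prop :=
  ∀ (k l m : K) (W : Opens X) (hk : W ≤ V k) (hl : W ≤ V l) (hm : W ≤ V m),
    rst F (le_inf hk hm) (c k m) = rst F (le_inf hk hl) (c k l) + rst F (le_inf hl hm) (c l m)

/-- A Čech 1-coboundary. -/
def IsOneCoboundary (F : (Opens X)ᵒᵖ ⥤ AddCommGrpCat.{u}) {K : Type*} (V : K → Opens X)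
    (c : ∀ k l, F.obj (op (V k ⊓ V l))) : Prop :=
  ∃ b : ∀ k, F.obj (op (V k)), ∀ k l, c k l = rst F inf_le_right (b l) - rst F inf_le_left (b k)

/-- A Čech 2-cocycle. -/
def IsTwoCocycle (F : (Opens X)ᵒᵖ ⥤ AddCommGrpCat.{u}) {K : Type*} (V : K → Opens X)
    (c : ∀ k l m, F.obj (op (V k ⊓ V l ⊓ V m))) : Prop :=
  ∀ (k l m n : K) (W : Opens X) (hk : W ≤ V k) (hl : W ≤ V l) (hm : W ≤ V m) (hn : W ≤ V n),
    rst F (le_inf (le_inf hk hl) hm) (c k l m) + rst F (le_inf (le_inf hk hm) hn) (c k m n) =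
    rst F (le_inf (le_inf hl hm) hn) (c l m n) + rst F (le_inf (le_inf hk hl) hn) (c k l n)

/-- A Čech 2-coboundary. -/
def IsTwoCoboundary (F : (Opens X)ᵒᵖ ⥤ AddCommGrpCat.{u}) {K : Type*} (V : K → Opens X)
    (c : ∀ k l m, F.obj (op (V k ⊓ V l ⊓ V m))) : Prop :=
  ∃ b : ∀ k l, F.obj (op (V k ⊓ V l)), ∀ k l m,
    c k l m = rst F inf_le_left (b k l) +
      rst F (le_inf (inf_le_left.trans inf_le_right) inf_le_right) (b l m) -
      rst F (le_inf (inf_le_left.trans inf_le_left) inf_le_right) (b k m)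

/-- The presheaf of families of germs. -/
def germPresheaf (F : (Opens X)ᵒᵖ ⥤ AddCommGrpCat.{u}) : (Opens X)ᵒᵖ ⥤ AddCommGrpCat.{u} where
  obj V := .of (∀ x : {x : X // x ∈ V.unop},
    (TopCat.Presheaf.stalk (C := AddCommGrpCat.{u}) F x.1 : Type u))
  map {V W} f := AddCommGrpCat.ofHom
    { toFun s x := s ⟨x.1, f.unop.le x.2⟩
      map_zero' := rfl
      map_add' _ _ := rfl }

/-- A section is sent to the family of its germs. -/
def toGermPresheaf (F : (Opens X)ᵒᵖ ⥤ AddCommGrpCat.{u}) : F ⟶ germPresheaf F where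
  app V := AddCommGrpCat.ofHom
    { toFun s x := TopCat.Presheaf.germ (C := AddCommGrpCat.{u}) F V.unop x.1 x.2 s
      map_zero' := funext fun _ => map_zero _
      map_add' _ _ := funext fun _ => map_add _ _ _ }
  naturality V W f := by
    ext s
    funext x
    exact TopCat.Presheaf.germ_res_apply F f.unop x.1 x.2 s

instance mono_toGermPresheaf (F : Sheaf (Opens.grothendieckTopology X) AddCommGrpCat.{u}) :
    Mono (toGermPresheaf F.obj) := by
  rw [NatTrans.mono_iff_mono_app]
  intro V
  rw [AddCommGrpCat.mono_iff_injective]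
  intro s t h
  exact TopCat.Presheaf.section_ext F V.unop s t fun x hx => congrFun h ⟨x, hx⟩

/-- Sheafification is left adjoint to the inclusion of sheaves into presheaves and preserves
monomorphisms, so the inclusion preserves injectives. Hence the embedding of an injective sheaf into
its families of germs splits already as a map of presheaves. -/
instance injective_obj (I : Sheaf (Opens.grothendieckTopology X) AddCommGrpCat.{u}) [Injective I] :
    Injective I.obj :=
  Injective.injective_of_adjoint (sheafificationAdjunction _ _) I

/-- A retraction of the embedding of an injective sheaf into the presheaf of families of germs. -/
def germRetract (I : Sheaf (Opens.grothendieckTopology X) AddCommGrpCat.{u}) [Injective I] :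
    germPresheaf I.obj ⟶ I.obj :=
  Injective.factorThru (𝟙 _) (toGermPresheaf I.obj)

lemma germRetract_toGermPresheaf (I : Sheaf (Opens.grothendieckTopology X) AddCommGrpCat.{u})
    [Injective I] {V : Opens X} (s : I.obj.obj (op V)) :
    ((germRetract I).app (op V)).hom (((toGermPresheaf I.obj).app (op V)).hom s) = s :=
  ConcreteCategory.congr_hom (congrArg (fun t => t.app (op V))
    (Injective.comp_factorThru (𝟙 _) (toGermPresheaf I.obj))) s

lemma IsTwoCocycle.map {F F' : (Opens X)ᵒᵖ ⥤ AddCommGrpCat.{u}} (φ : F ⟶ F') {K : Type*}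
    {V : K → Opens X} {c : ∀ k l m, F.obj (op (V k ⊓ V l ⊓ V m))} (hc : IsTwoCocycle F V c) :
    IsTwoCocycle F' V fun k l m => (φ.app _).hom (c k l m) := by
  intro k l m n W hk hl hm hn
  have := congrArg (φ.app (op W)).hom (hc k l m n W hk hl hm hn)
  simpa only [map_add, rst_app] using this

lemma IsTwoCoboundary.map {F F' : (Opens X)ᵒᵖ ⥤ AddCommGrpCat.{u}} (φ : F ⟶ F') {K : Type*}
    {V : K → Opens X} {c : ∀ k l m, F.obj (op (V k ⊓ V l ⊓ V m))} (hc : IsTwoCoboundary F V c) :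
    IsTwoCoboundary F' V fun k l m => (φ.app _).hom (c k l m) := by
  obtain ⟨b, hb⟩ := hc
  refine ⟨fun k l => (φ.app _).hom (b k l), fun k l m => ?_⟩
  simp only [hb, map_add, map_sub, rst_app]

lemma IsOneCocycle.map {F F' : (Opens X)ᵒᵖ ⥤ AddCommGrpCat.{u}} (φ : F ⟶ F') {K : Type*}
    {V : K → Opens X} {c : ∀ k l, F.obj (op (V k ⊓ V l))} (hc : IsOneCocycle F V c) :
    IsOneCocycle F' V fun k l => (φ.app _).hom (c k l) := by
  intro k l m W hk hl hm
  have := congrArg (φ.app (op W)).hom (hc k l m W hk hl hm)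
  simpa only [map_add, rst_app] using this

lemma IsOneCoboundary.map {F F' : (Opens X)ᵒᵖ ⥤ AddCommGrpCat.{u}} (φ : F ⟶ F') {K : Type*}
    {V : K → Opens X} {c : ∀ k l, F.obj (op (V k ⊓ V l))} (hc : IsOneCoboundary F V c) :
    IsOneCoboundary F' V fun k l => (φ.app _).hom (c k l) := by
  obtain ⟨b, hb⟩ := hc
  refine ⟨fun k => (φ.app _).hom (b k), fun k l => ?_⟩
  simp only [hb, map_sub, rst_app]

/-- Families of germs need no continuity, so a contracting homotopy can be chosen point by point: `b
k` at `x` is the value of `c` at the pair `(m x, k)`, for one index `m x` with `x ∈ V (m x)`. -/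
lemma germPresheaf_isOneCoboundary (F : (Opens X)ᵒᵖ ⥤ AddCommGrpCat.{u}) {K : Type*}
    {V : K → Opens X} {c : ∀ k l, (germPresheaf F).obj (op (V k ⊓ V l))}
    (hc : IsOneCocycle (germPresheaf F) V c) : IsOneCoboundary (germPresheaf F) V c := by
  -- By proof irrelevance the index depends on `x` only, so `b k` and `b l` use the same one.
  let m (x : X) (h : ∃ k, x ∈ V k) : K := h.choose
  have hm (x : X) (h : ∃ k, x ∈ V k) : x ∈ V (m x h) := h.choose_spec
  let b (k : K) : (germPresheaf F).obj (op (V k)) :=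
    fun x : {x : X // x ∈ V k} =>
      (c (m x.1 ⟨k, x.2⟩) k : ∀ y : {y : X // y ∈ V (m x.1 ⟨k, x.2⟩) ⊓ V k},
        TopCat.Presheaf.stalk (C := AddCommGrpCat.{u}) F y.1)
        ⟨x.1, hm x.1 ⟨k, x.2⟩, x.2⟩
  refine ⟨b, fun k l => ?_⟩
  funext ⟨x, hk, hl⟩
  exact eq_sub_of_add_eq' (congrFun (hc (m x ⟨k, hk⟩) k l (V (m x ⟨k, hk⟩) ⊓ V k ⊓ V l)
    (inf_le_left.trans inf_le_left) (inf_le_left.trans inf_le_right) inf_le_right)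
    ⟨x, ⟨hm x ⟨k, hk⟩, hk⟩, hl⟩).symm

lemma germPresheaf_isTwoCoboundary (F : (Opens X)ᵒᵖ ⥤ AddCommGrpCat.{u}) {K : Type*}
    {V : K → Opens X} {c : ∀ k l m, (germPresheaf F).obj (op (V k ⊓ V l ⊓ V m))}
    (hc : IsTwoCocycle (germPresheaf F) V c) : IsTwoCoboundary (germPresheaf F) V c := by
  let m (x : X) (h : ∃ k, x ∈ V k) : K := h.choose
  have hm (x : X) (h : ∃ k, x ∈ V k) : x ∈ V (m x h) := h.choose_spec
  let b (k l : K) : (germPresheaf F).obj (op (V k ⊓ V l)) :=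
    fun x : {x : X // x ∈ V k ⊓ V l} =>
      (c (m x.1 ⟨k, x.2.1⟩) k l : ∀ y : {y : X // y ∈ V (m x.1 ⟨k, x.2.1⟩) ⊓ V k ⊓ V l},
        TopCat.Presheaf.stalk (C := AddCommGrpCat.{u}) F y.1)
        ⟨x.1, ⟨hm x.1 ⟨k, x.2.1⟩, x.2.1⟩, x.2.2⟩
  refine ⟨b, fun k l n => ?_⟩
  funext ⟨x, ⟨hk, hl⟩, hn⟩
  exact eq_sub_of_add_eq (congrFun (hc (m x ⟨k, hk⟩) k l n (V (m x ⟨k, hk⟩) ⊓ V k ⊓ V l ⊓ V n)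
    (inf_le_left.trans (inf_le_left.trans inf_le_left))
    (inf_le_left.trans (inf_le_left.trans inf_le_right)) (inf_le_left.trans inf_le_right)
    inf_le_right) ⟨x, ⟨⟨hm x ⟨k, hk⟩, hk⟩, hl⟩, hn⟩).symm

variable (I : Sheaf (Opens.grothendieckTopology X) AddCommGrpCat.{u}) [Injective I]

lemma isOneCoboundary_of_injective {K : Type*} {V : K → Opens X}
    {c : ∀ k l, I.obj.obj (op (V k ⊓ V l))} (hc : IsOneCocycle I.obj V c) :
    IsOneCoboundary I.obj V c := by
  have := (germPresheaf_isOneCoboundary _ (hc.map (toGermPresheaf I.obj))).map (germRetract I)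
  simpa only [germRetract_toGermPresheaf] using this

lemma isTwoCoboundary_of_injective {K : Type*} {V : K → Opens X}
    {c : ∀ k l m, I.obj.obj (op (V k ⊓ V l ⊓ V m))} (hc : IsTwoCocycle I.obj V c) :
    IsTwoCoboundary I.obj V c := by
  have := (germPresheaf_isTwoCoboundary _ (hc.map (toGermPresheaf I.obj))).map (germRetract I)
  simpa only [germRetract_toGermPresheaf] using this

end Cech

/-! ### Čech cocycles and sheaf cohomology -/

section Cohomology

variable {X : TopCat.{u}}

/-- Sections over `U` as morphisms from the free abelian sheaf generated by `U`. -/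
def freeHomEquiv (U : Opens X) (F : Sheaf (Opens.grothendieckTopology X) AddCommGrpCat.{u}) :
    ((presheafToSheaf (Opens.grothendieckTopology X) AddCommGrpCat.{u}).obj
      (yoneda.obj U ⋙ AddCommGrpCat.free) ⟶ F) ≃ F.obj.obj (op U) :=
  ((sheafificationAdjunction _ _).homEquiv _ _).trans
    (((AddCommGrpCat.adj.whiskerRight _).homEquiv _ _).trans yonedaEquiv)

lemma freeHomEquiv_comp (U : Opens X)
    {F F' : Sheaf (Opens.grothendieckTopology X) AddCommGrpCat.{u}} (φ : _ ⟶ F) (g : F ⟶ F') :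
    freeHomEquiv U F' (φ ≫ g) = (g.hom.app (op U)).hom (freeHomEquiv U F φ) := by
  simp only [freeHomEquiv, Equiv.trans_apply, Adjunction.homEquiv_naturality_right]
  rfl

variable {S : ShortComplex (Sheaf (Opens.grothendieckTopology X) AddCommGrpCat.{u})}

lemma exists_lift_of_subsingleton (hS : S.ShortExact) (U : Opens X)
    (h : Subsingleton (Sheaf.H'.{u} S.X₁ 1 U)) (s : S.X₃.obj.obj (op U)) :
    ∃ t : S.X₂.obj.obj (op U), (S.g.hom.app (op U)).hom t = s := by
  obtain ⟨φ, rfl⟩ := (freeHomEquiv U _).surjective s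
  let A := (presheafToSheaf (Opens.grothendieckTopology X) AddCommGrpCat.{u}).obj
    (yoneda.obj U ⋙ AddCommGrpCat.free)
  obtain ⟨x, hx⟩ := Abelian.Ext.covariant_sequence_exact₃ A hS (Abelian.Ext.mk₀ φ) rfl
    (h.elim _ _)
  obtain ⟨ψ, rfl⟩ := (Abelian.Ext.mk₀_bijective A S.X₂).2 x
  rw [Abelian.Ext.mk₀_comp_mk₀] at hx
  exact ⟨freeHomEquiv U _ ψ, by
    rw [← freeHomEquiv_comp, (Abelian.Ext.mk₀_bijective A S.X₃).1 hx]⟩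

/-- Dimension shift: the connecting map out of degree one is injective, since Ext into the injective
middle term vanishes there. -/
lemma subsingleton_one_of_two (hS : S.ShortExact) [Injective S.X₂] (U : Opens X)
    (h : Subsingleton (Sheaf.H'.{u} S.X₁ 2 U)) : Subsingleton (Sheaf.H'.{u} S.X₃ 1 U) := by
  refine subsingleton_of_forall_eq 0 fun x => ?_
  obtain ⟨y, hy⟩ := Abelian.Ext.covariant_sequence_exact₃ _ hS x rfl (h.elim _ _)
  rw [← hy, Abelian.Ext.eq_zero_of_injective y]
  exact Abelian.Ext.zero_comp ((presheafToSheaf (Opens.grothendieckTopology X)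
    AddCommGrpCat.{u}).obj (yoneda.obj U ⋙ AddCommGrpCat.free)) _ _ _ _

lemma exact_sections (hS : S.ShortExact) {U : Opens X} (t : S.X₂.obj.obj (op U))
    (ht : (S.g.hom.app (op U)).hom t = 0) :
    ∃ s : S.X₁.obj.obj (op U), (S.f.hom.app (op U)).hom s = t := by
  obtain ⟨φ, rfl⟩ := (freeHomEquiv U _).surjective t
  have h0 : φ ≫ S.g = 0 := by
    apply (freeHomEquiv U _).injective
    rw [freeHomEquiv_comp, ht]
    have := freeHomEquiv_comp U (0 : _ ⟶ S.X₃) (0 : S.X₃ ⟶ S.X₃)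
    rw [Limits.comp_zero] at this
    rw [this]
    rfl
  have := hS.mono_f
  refine ⟨freeHomEquiv U _ (hS.exact.lift φ h0), ?_⟩
  rw [← freeHomEquiv_comp, hS.exact.lift_f]

lemma injective_sections (hS : S.ShortExact) {U : Opens X} :
    Function.Injective (S.f.hom.app (op U)).hom := by
  intro s t h
  obtain ⟨φ, rfl⟩ := (freeHomEquiv U _).surjective s
  obtain ⟨ψ, rfl⟩ := (freeHomEquiv U _).surjective t
  rw [← freeHomEquiv_comp, ← freeHomEquiv_comp] at h
  have := hS.mono_f
  rw [(cancel_mono S.f).1 ((freeHomEquiv U _).injective h)]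

lemma exists_injective_embedding (F : Sheaf (Opens.grothendieckTopology X) AddCommGrpCat.{u}) :
    ∃ S : ShortComplex (Sheaf (Opens.grothendieckTopology X) AddCommGrpCat.{u}),
      S.ShortExact ∧ Injective S.X₂ ∧ S.X₁ = F :=
  ⟨ShortComplex.mk (Injective.ι F) (Limits.cokernel.π (Injective.ι F))
    (Limits.cokernel.condition _),
    { exact := ShortComplex.exact_cokernel _, mono_f := inferInstanceAs (Mono (Injective.ι F)),
      epi_g := inferInstanceAs (Epi (Limits.cokernel.π _)) },
    inferInstanceAs (Injective (Injective.under F)), rfl⟩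

/-- In an injective sheaf containing `F` the cocycle bounds some `a`. The images of the `a k` in the
quotient agree on overlaps and glue to a section over `U`; subtracting a lift of it moves `a` into
`F` without changing its coboundary. -/
theorem isOneCoboundary_of_subsingleton
    (F : Sheaf (Opens.grothendieckTopology X) AddCommGrpCat.{u}) {U : Opens X}
    (h : Subsingleton (Sheaf.H'.{u} F 1 U)) {K : Type*} {V : K → Opens X} (hV : iSup V = U)
    {c : ∀ k l, F.obj.obj (op (V k ⊓ V l))} (hc : IsOneCocycle F.obj V c) :
    IsOneCoboundary F.obj V c := by
  obtain ⟨S, hS, hI, rfl⟩ := exists_injective_embedding F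
  have hg0 (W : Opens X) (s : S.X₁.obj.obj (op W)) :
      (S.g.hom.app (op W)).hom ((S.f.hom.app (op W)).hom s) = 0 :=
    ConcreteCategory.congr_hom (congrArg (fun t => t.hom.app (op W)) S.zero) s
  obtain ⟨a, ha⟩ := isOneCoboundary_of_injective S.X₂ (hc.map S.f.hom)
  subst hV
  obtain ⟨q, hq⟩ := exists_rst_eq S.X₃ V (iSup V) (le_iSup V) le_rfl
    (fun k => (S.g.hom.app _).hom (a k)) (fun k l => by
      have := congrArg (S.g.hom.app _).hom (ha k l)
      rw [hg0, map_sub, rst_app, rst_app] at this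
      exact (sub_eq_zero.1 this.symm).symm)
  -- The obstruction to lifting `q` to the injective sheaf lies in the vanishing group of degree
  -- one.
  obtain ⟨t, ht⟩ := exists_lift_of_subsingleton hS _ h q
  have key (k : K) := exact_sections hS (a k - rst S.X₂.obj (le_iSup V k) t) (by
    rw [map_sub, rst_app, ht, hq, sub_self])
  choose b hb using key
  refine ⟨b, fun k l => injective_sections hS ?_⟩
  refine (ha k l).trans ?_
  rw [map_sub, rst_app, rst_app, hb, hb]
  simp

/-- The degree-one argument is applied to the quotient of an injective embedding. Lifting the
resulting 0-cochain back uses degree-one vanishing on the members `V k` alone; overlaps play no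
role. -/
theorem isTwoCoboundary_of_subsingleton
    (F : Sheaf (Opens.grothendieckTopology X) AddCommGrpCat.{u}) {U : Opens X}
    (h : Subsingleton (Sheaf.H'.{u} F 2 U)) {K : Type*} {V : K → Opens X} (hV : iSup V = U)
    (h' : ∀ k, Subsingleton (Sheaf.H'.{u} F 1 (V k)))
    {c : ∀ k l m, F.obj.obj (op (V k ⊓ V l ⊓ V m))} (hc : IsTwoCocycle F.obj V c) :
    IsTwoCoboundary F.obj V c := by
  obtain ⟨S, hS, hI, rfl⟩ := exists_injective_embedding F
  have hg0 (W : Opens X) (s : S.X₁.obj.obj (op W)) :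
      (S.g.hom.app (op W)).hom ((S.f.hom.app (op W)).hom s) = 0 :=
    ConcreteCategory.congr_hom (congrArg (fun t => t.hom.app (op W)) S.zero) s
  obtain ⟨a, ha⟩ := isTwoCoboundary_of_injective S.X₂ (hc.map S.f.hom)
  -- The coboundary of `a` comes from `F`, so it dies in the quotient.
  have hq : IsOneCocycle S.X₃.obj V fun k l => (S.g.hom.app _).hom (a k l) := by
    intro k l m W hk hl hm
    have := congrArg (rst S.X₃.obj (le_inf (le_inf hk hl) hm))
      (congrArg (S.g.hom.app _).hom (ha k l m))
    rw [hg0] at this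
    simp only [map_zero, map_add, map_sub, rst_app, rst_rst] at this
    exact (sub_eq_zero.1 this.symm).symm
  obtain ⟨e, he⟩ := isOneCoboundary_of_subsingleton S.X₃ (subsingleton_one_of_two hS U h) hV hq
  choose d hd using fun k => exists_lift_of_subsingleton hS _ (h' k) (e k)
  have key (k l : K) := exact_sections hS
    (a k l - (rst S.X₂.obj inf_le_right (d l) - rst S.X₂.obj inf_le_left (d k))) (by
    rw [map_sub, map_sub, rst_app, rst_app, hd, hd]
    exact sub_eq_zero.2 (he k l))
  choose b hb using key
  refine ⟨b, fun k l m => injective_sections hS ?_⟩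
  refine (ha k l m).trans ?_
  simp only [map_add, map_sub, rst_app, rst_rst, hb]
  abel

end Cohomology

/-! ### Restriction of isomorphisms between restricted objects -/

section Restriction

variable {X : TopCat.{u}} {G : PrestackOn.{u, w} X}

/-- The restriction of a local object along an inequality of open sets. -/
abbrev rob {V W : Opens X} (b : Sec G V) (h : W ≤ V) : Sec G W := res (homOfLE h) b

lemma pullHom_trans {V₁ V₂ V₃ W W' : Opens X} {b : Sec G V₁} {c : Sec G V₂} {d : Sec G V₃}
    {h₁ : W ≤ V₁} {h₂ : W ≤ V₂} {h₃ : W ≤ V₃} (φ : rob b h₁ ⟶ rob c h₂) (ψ : rob c h₂ ⟶ rob d h₃)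
    (h : W' ≤ W) :
    pullHom (φ ≫ ψ) (homOfLE h) (homOfLE (h.trans h₁)) (homOfLE (h.trans h₃)) =
      pullHom φ (homOfLE h) (homOfLE (h.trans h₁)) (homOfLE (h.trans h₂)) ≫
        pullHom ψ (homOfLE h) (homOfLE (h.trans h₂)) (homOfLE (h.trans h₃)) := by
  simp [pullHom, ← reassoc_of% Cat.Hom₂.comp_app]

lemma pullHom_one {V W W' : Opens X} (b : Sec G V) (h₁ : W ≤ V) (h : W' ≤ W) :
    pullHom (𝟙 (rob b h₁)) (homOfLE h) (homOfLE (h.trans h₁)) (homOfLE (h.trans h₁)) = 𝟙 _ := by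
  simp [pullHom, ← Cat.Hom₂.comp_app]

/-- Restriction of an isomorphism between two restricted objects. -/
def ris {V₁ V₂ W W' : Opens X} {b : Sec G V₁} {c : Sec G V₂} {h₁ : W ≤ V₁} {h₂ : W ≤ V₂}
    (h : W' ≤ W) (φ : rob b h₁ ≅ rob c h₂) : rob b (h.trans h₁) ≅ rob c (h.trans h₂) where
  hom := pullHom φ.hom (homOfLE h) _ _
  inv := pullHom φ.inv (homOfLE h) _ _
  hom_inv_id := by rw [← pullHom_trans, Iso.hom_inv_id, pullHom_one]
  inv_hom_id := by rw [← pullHom_trans, Iso.inv_hom_id, pullHom_one]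

section

variable {V₁ V₂ V₃ W W' W'' : Opens X} {b : Sec G V₁} {c : Sec G V₂} {d : Sec G V₃}
  {h₁ : W ≤ V₁} {h₂ : W ≤ V₂} {h₃ : W ≤ V₃}

@[simp]
lemma ris_trans (h : W' ≤ W) (φ : rob b h₁ ≅ rob c h₂) (ψ : rob c h₂ ≅ rob d h₃) :
    ris h (φ ≪≫ ψ) = ris h φ ≪≫ ris h ψ :=
  Iso.ext (pullHom_trans φ.hom ψ.hom h)

@[simp]
lemma ris_symm (h : W' ≤ W) (φ : rob b h₁ ≅ rob c h₂) : ris h φ.symm = (ris h φ).symm := rfl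

-- A strict equality is possible because both sides compare direct restrictions of the fixed objects
-- `b` and `c`; the coherence isomorphisms are absorbed by `pullHom`. This lets `simp` carry out all
-- later computations on overlaps.
@[simp]
lemma ris_ris (h : W' ≤ W) (h' : W'' ≤ W') (φ : rob b h₁ ≅ rob c h₂) :
    ris h' (ris h φ) = ris (h'.trans h) φ :=
  Iso.ext (pullHom_pullHom _ _ _ _ _ _ _)

@[simp]
lemma ris_self (h : W ≤ W) (φ : rob b h₁ ≅ rob c h₂) : ris h φ = φ :=
  Iso.ext (pullHom_id _)

lemma pullAut_eq_ris (h : W' ≤ W) (a : Aut (rob b h₁)) :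
    pullAut (homOfLE h₁) (homOfLE h) (homOfLE (h.trans h₁)) b a = ris h a :=
  Iso.ext (pullAut_hom _ _ _ _ _)

variable (b) in
/-- Transitivity of restriction of objects. -/
def robTrans (h₁ : W ≤ V₁) (h : W' ≤ W) : rob (rob b h₁) h ≅ rob b (h.trans h₁) :=
  ((Cat.Hom.toNatIso (G.mapComp' (homOfLE h₁).op.toLoc (homOfLE h).op.toLoc
    (homOfLE (h.trans h₁)).op.toLoc (by cat_disch))).app b).symm

lemma conjAut_robTrans (h : W' ≤ W) (a : Aut (rob b h₁)) :
    (robTrans b h₁ h).conjAut (resAut (homOfLE h) (rob b h₁) a) = ris h a :=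
  pullAut_eq_ris h a

lemma exists_iso [IsGerbe G] (b : Sec G V₁) (c : Sec G V₂) (h₁ : W ≤ V₁) (h₂ : W ≤ V₂) (x : X)
    (hx : x ∈ W) : ∃ (W' : Opens X) (h : W' ≤ W), x ∈ W' ∧
      Nonempty (rob b (h.trans h₁) ≅ rob c (h.trans h₂)) := by
  obtain ⟨W', f, hx', ⟨g⟩⟩ := IsGerbe.locally_connected W (rob b h₁) (rob c h₂) x hx
  have := (IsGerbe.isGroupoid (G := G) W').all_isIso g
  let e : rob (rob b h₁) f.le ≅ rob (rob c h₂) f.le := @asIso _ _ _ _ g this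
  exact ⟨W', f.le, hx', ⟨(robTrans b h₁ f.le).symm ≪≫ e ≪≫ robTrans c h₂ f.le⟩⟩

end

lemma conjAut_eq {C : Type*} [Category C] {a b : C} (c : a ≅ b) (f : Aut a) :
    c.conjAut f = c.symm ≪≫ f ≪≫ c := by
  ext
  simp [Iso.conj_apply]
  rfl

end Restriction

/-! ### Membership of isomorphisms in a normal subgroupoid -/

namespace NormalSubgroupoid

variable {X : TopCat.{u}} {G : PrestackOn.{u, w} X} (N : NormalSubgroupoid G)
  {V₁ V₂ V₃ W W' W'' : Opens X} {b : Sec G V₁} {c : Sec G V₂} {d : Sec G V₃}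
  {h₁ : W ≤ V₁} {h₂ : W ≤ V₂} {h₃ : W ≤ V₃}

/-- Membership in the normal subgroupoid, for an isomorphism of a local object with itself. -/
def Mem {i : Sec G W} (n : i ≅ i) : Prop := (show Aut i from n) ∈ N.grp i

variable {N}

lemma Mem.trans {i : Sec G W} {m n : i ≅ i} (hm : N.Mem m) (hn : N.Mem n) : N.Mem (m ≪≫ n) :=
  (N.grp i).mul_mem hn hm

lemma Mem.symm {i : Sec G W} {n : i ≅ i} (hn : N.Mem n) : N.Mem n.symm :=
  (N.grp i).inv_mem hn

lemma Mem.conj {i j : Sec G W} (g : i ≅ j) {n : i ≅ i} (hn : N.Mem n) :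
    N.Mem (g.symm ≪≫ n ≪≫ g) := by
  have := N.conj_mem g n hn
  have e : g.conjAut n = g.symm ≪≫ n ≪≫ g := conjAut_eq g n
  exact e ▸ this

lemma Mem.ris (h : W' ≤ W) {n : rob b h₁ ≅ rob b h₁} (hn : N.Mem n) : N.Mem (ris h n) := by
  have := N.pull_mem (homOfLE h₁) (homOfLE h) (homOfLE (h.trans h₁)) b n hn
  exact (pullAut_eq_ris h n) ▸ this

lemma mem_of_locally {n : rob b h₁ ≅ rob b h₁}
    (hn : ∀ x ∈ W, ∃ (W' : Opens X) (h : W' ≤ W), x ∈ W' ∧ N.Mem (PronilpotentGerbe.ris h n)) :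
    N.Mem n := by
  refine N.local_mem _ _ fun x hx => ?_
  obtain ⟨W', h, hx', hm⟩ := hn x hx
  refine ⟨W', homOfLE h, hx', ?_⟩
  have e : (robTrans b h₁ h).symm.conjAut (PronilpotentGerbe.ris h n) =
      resAut (homOfLE h) (rob b h₁) n :=
    (congrArg _ (conjAut_robTrans h n).symm).trans (conjAut_symm_conjAut _ _)
  exact e ▸ N.conj_mem (robTrans b h₁ h).symm _ hm

end NormalSubgroupoid

/-! ### Central pairs -/

namespace NormalSubgroupoid

section CentralPair

variable {X : TopCat.{u}} {G : PrestackOn.{u, w} X} (M N : NormalSubgroupoid G)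

/-- `M / N` is central in `G / N`. -/
def IsCentralPair : Prop :=
  ∀ ⦃U : Opens X⦄ (i : Sec G U) (g a : i ≅ i), M.Mem a → N.Mem (g.symm ≪≫ a ≪≫ g ≪≫ a.symm)

-- Two isomorphisms `g`, `g'` differ by the automorphism `g ≪≫ g'.symm` of `i`, whose commutator
-- with `a` lies in `N`. This is why transport between local objects is canonical on `M / N`.
variable {M N} in
lemma IsCentralPair.conj_trans_symm (hc : IsCentralPair M N) {V : Opens X} {i j : Sec G V} (g g' : i ≅ j)
    (a : i ≅ i) (ha : M.Mem a) :
    N.Mem ((g.symm ≪≫ a ≪≫ g) ≪≫ (g'.symm ≪≫ a ≪≫ g').symm) := by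
  have := (hc i (g ≪≫ g'.symm) a ha).conj g'
  simpa using this

variable {M N} {V : Opens X}

/-- The commutative group `M(i, i) / N(i, i)`. -/
@[reducible]
def quotCommGroup (hc : IsCentralPair M N) (i : Sec G V) :
    CommGroup (M.grp i ⧸ (N.grp i).subgroupOf (M.grp i)) where
  mul_comm p q := by
    induction p using QuotientGroup.induction_on with
    | H p =>
    induction q using QuotientGroup.induction_on with
    | H q =>
    rw [← QuotientGroup.mk_mul, ← QuotientGroup.mk_mul, QuotientGroup.eq,
      Subgroup.mem_subgroupOf]
    have e : (((p * q)⁻¹ * (q * p) : M.grp i) : Aut i) = (q.1⁻¹ * p.1⁻¹ * q.1) * p.1 := by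
      push_cast
      group
    rw [e]
    exact hc i (p.1 : i ≅ i).symm q.1 q.2

lemma quot_eq_of_isos (hc : IsCentralPair M N) {i j : Sec G V} (g g' : i ≅ j) (a : M.grp i) :
    (M.Ad g a : M.grp j ⧸ (N.grp j).subgroupOf (M.grp j)) = M.Ad g' a := by
  rw [QuotientGroup.eq, Subgroup.mem_subgroupOf]
  have e : (((M.Ad g a)⁻¹ * M.Ad g' a : M.grp j) : Aut j) =
      (g'.symm ≪≫ a.1 ≪≫ g') ≪≫ (g.symm ≪≫ a.1 ≪≫ g).symm := by
    rw [← conjAut_eq, ← conjAut_eq]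
    rfl
  exact e ▸ hc.conj_trans_symm g' g a.1 a.2

end CentralPair

/-! ### Sections of the band defined by automorphisms of local objects -/

section BandClass

variable {X : TopCat.{u}} {G : PrestackOn.{u, w} X} [IsGerbe G] (M N : NormalSubgroupoid G)
  {V₁ V₂ V W W' : Opens X} {b : Sec G V₁} {c : Sec G V₂} {h₁ : W ≤ V₁} {h₂ : W ≤ V₂}

/-- The section of the presheaf of bands given by an automorphism of a chart object. -/
def preClass (x : ChartOn G V) (a : x.obj ≅ x.obj) (ha : M.Mem a) :
    (bandPresheaf M N).obj (op V) :=
  QuotientAddGroup.mk (s := bandRelations M N V) (FreeAbelianGroup.of ⟨x, ⟨a, ha⟩⟩)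

/-- The canonical map from the presheaf of bands to the band. -/
def toBand (V : Opens X) : (bandPresheaf M N).obj (op V) →+ (band M N).obj.obj (op V) :=
  ((toSheafify (Opens.grothendieckTopology X) (bandPresheaf M N)).app (op V)).hom

lemma rst_toBand (h : W ≤ V) (z : (bandPresheaf M N).obj (op V)) :
    rst (band M N).obj h (toBand M N V z) = toBand M N W (rst (bandPresheaf M N) h z) :=
  (rst_app (toSheafify (Opens.grothendieckTopology X) (bandPresheaf M N)) h z).symm

lemma rst_preClass (h : W ≤ V) (x : ChartOn G V) (a : x.obj ≅ x.obj) (ha : M.Mem a) :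
    rst (bandPresheaf M N) h (preClass M N x a ha) =
      preClass M N (x.restrict (homOfLE h)) (ris h a) (ha.ris h) := by
  have e : M.chartPull (homOfLE h) x ⟨a, ha⟩ = ⟨ris h a, ha.ris h⟩ :=
    Subtype.ext (pullAut_eq_ris h a)
  exact congrArg (fun t => QuotientAddGroup.mk (s := bandRelations M N W)
    (FreeAbelianGroup.of ⟨x.restrict (homOfLE h), t⟩)) e

/-- The section of the band given by an automorphism of a chart object. -/
def chartClass (x : ChartOn G V) (a : x.obj ≅ x.obj) (ha : M.Mem a) :
    (band M N).obj.obj (op V) :=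
  toBand M N V (preClass M N x a ha)

lemma rst_chartClass (h : W ≤ V) (x : ChartOn G V) (a : x.obj ≅ x.obj) (ha : M.Mem a) :
    rst (band M N).obj h (chartClass M N x a ha) =
      chartClass M N (x.restrict (homOfLE h)) (ris h a) (ha.ris h) := by
  rw [chartClass, rst_toBand, rst_preClass, chartClass]

lemma chartClass_trans (x : ChartOn G V) (a a' : x.obj ≅ x.obj) (ha : M.Mem a) (ha' : M.Mem a') :
    chartClass M N x (a ≪≫ a') (ha.trans ha') =
      chartClass M N x a ha + chartClass M N x a' ha' := by
  rw [chartClass, chartClass, chartClass, ← map_add]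
  refine congrArg _ ?_
  -- Multiplication in `Aut` is composition in the reverse order, so `a` and `a'` are exchanged.
  have h := (QuotientAddGroup.eq_zero_iff _).2
    (AddSubgroup.subset_closure (BandRel.mul (N := N) x ⟨a', ha'⟩ ⟨a, ha⟩))
  rw [QuotientAddGroup.mk_sub, QuotientAddGroup.mk_sub, sub_sub, sub_eq_zero, add_comm] at h
  exact h

lemma chartClass_conj (x y : ChartOn G V) (g : x.obj ≅ y.obj) (a : x.obj ≅ x.obj) (ha : M.Mem a) :
    chartClass M N y (g.symm ≪≫ a ≪≫ g) (ha.conj g) = chartClass M N x a ha := by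
  refine congrArg (toBand M N V) ?_
  have h := (QuotientAddGroup.eq_zero_iff _).2
    (AddSubgroup.subset_closure (BandRel.ad (N := N) x y g ⟨a, ha⟩))
  rw [QuotientAddGroup.mk_sub, sub_eq_zero] at h
  have e : M.Ad g ⟨a, ha⟩ = ⟨g.symm ≪≫ a ≪≫ g, ha.conj g⟩ := Subtype.ext (conjAut_eq g a)
  rw [e] at h
  exact h.symm

variable {M N} in
lemma chartClass_eq_zero (x : ChartOn G V) (a : x.obj ≅ x.obj) (ha : M.Mem a) (ha' : N.Mem a) :
    chartClass M N x a ha = 0 := by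
  rw [← map_zero (toBand M N V)]
  exact congrArg _ ((QuotientAddGroup.eq_zero_iff _).2
    (AddSubgroup.subset_closure (BandRel.kill (N := N) x ⟨a, ha⟩ ha')))

variable {M N}

/-- Detection of the class of an automorphism of a chart object. -/
def detect (hc : IsCentralPair M N) (x : ChartOn G V) :
    letI := quotCommGroup hc x.obj
    FreeAbelianGroup (BandGen M V) →+
      Additive (M.grp x.obj ⧸ (N.grp x.obj).subgroupOf (M.grp x.obj)) :=
  letI := quotCommGroup hc x.obj
  open Classical in
  FreeAbelianGroup.lift fun s => if h : Nonempty (s.1.obj ≅ x.obj) then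
    Additive.ofMul (QuotientGroup.mk (M.Ad h.some s.2)) else 0

lemma detect_of (hc : IsCentralPair M N) (x y : ChartOn G V) (g : y.obj ≅ x.obj)
    (a : M.grp y.obj) : detect hc x (FreeAbelianGroup.of ⟨y, a⟩) =
      Additive.ofMul (QuotientGroup.mk (M.Ad g a)) := by
  let := quotCommGroup hc x.obj
  have h : Nonempty (y.obj ≅ x.obj) := ⟨g⟩
  refine (FreeAbelianGroup.lift_apply_of _ _).trans ?_
  rw [dif_pos h]
  exact congrArg _ (quot_eq_of_isos hc _ _ _)

lemma detect_of_isEmpty (hc : IsCentralPair M N) (x y : ChartOn G V)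
    (h : ¬ Nonempty (y.obj ≅ x.obj)) (a : M.grp y.obj) : detect hc x (FreeAbelianGroup.of ⟨y, a⟩) = 0 := by
  let := quotCommGroup hc x.obj
  refine (FreeAbelianGroup.lift_apply_of _ _).trans ?_
  rw [dif_neg h]

/-- Generators and relations could kill more than `N`; `detect` is the invariant that excludes this.
It moves each generator to `x` by any isomorphism, the choice being harmless by centrality, and
discards generators whose object is not isomorphic to `x.obj`. The relation `ad` only links
isomorphic objects, so it never mixes the two cases. -/
lemma bandRelations_le_ker (hc : IsCentralPair M N) (x : ChartOn G V) :
    letI := quotCommGroup hc x.obj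
    bandRelations M N V ≤ (detect hc x).ker := by
  let := quotCommGroup hc x.obj
  refine (AddSubgroup.closure_le _).2 fun z hz => ?_
  change detect hc x z = 0
  cases hz with
  | mul y a a' =>
    rw [map_sub, map_sub]
    by_cases h : Nonempty (y.obj ≅ x.obj)
    · obtain ⟨g⟩ := h
      simp only [detect_of hc x y g, map_mul, QuotientGroup.mk_mul, ofMul_mul]
      abel
    · simp only [detect_of_isEmpty hc x y h, sub_zero]
  | kill y a ha =>
    by_cases h : Nonempty (y.obj ≅ x.obj)
    · obtain ⟨g⟩ := h
      rw [detect_of hc x y g]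
      exact congrArg Additive.ofMul ((QuotientGroup.eq_one_iff _).2 (N.conj_mem g a.1 ha))
    · rw [detect_of_isEmpty hc x y h]
  | ad y y' g a =>
    rw [map_sub]
    by_cases h : Nonempty (y'.obj ≅ x.obj)
    · obtain ⟨g'⟩ := h
      rw [detect_of hc x y' g', detect_of hc x y (g ≪≫ g'), sub_eq_zero]
      refine congrArg (fun t => Additive.ofMul (QuotientGroup.mk t)) (Subtype.ext ?_)
      exact Iso.trans_conjAut g g' a.1
    · rw [detect_of_isEmpty hc x y' h, detect_of_isEmpty hc x y (fun ⟨t⟩ => h ⟨g.symm ≪≫ t⟩),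
        sub_zero]

lemma mem_of_preClass_eq_zero (hc : IsCentralPair M N) (x : ChartOn G V) (a : x.obj ≅ x.obj)
    (ha : M.Mem a) (h : preClass M N x a ha = 0) : N.Mem a := by
  let := quotCommGroup hc x.obj
  have h' := bandRelations_le_ker hc x ((QuotientAddGroup.eq_zero_iff _).1 h)
  have h'' : detect hc x (FreeAbelianGroup.of ⟨x, ⟨a, ha⟩⟩) = 0 := h'
  rw [detect_of hc x x (Iso.refl _)] at h''
  have := (QuotientGroup.eq_one_iff _).1 (Additive.ofMul.injective h'')
  rw [Subgroup.mem_subgroupOf] at this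
  have e : (M.Ad (Iso.refl x.obj) ⟨a, ha⟩ : Aut x.obj) = a := by
    refine (conjAut_eq _ _).trans ?_
    ext
    simp
  exact e ▸ this

lemma toBand_eq_zero (z : (bandPresheaf M N).obj (op V)) (hz : toBand M N V z = 0) (y : X)
    (hy : y ∈ V) : ∃ (W : Opens X) (h : W ≤ V), y ∈ W ∧ rst (bandPresheaf M N) h z = 0 := by
  have := Presheaf.equalizerSieve_mem (Opens.grothendieckTopology X)
    (toSheafify (Opens.grothendieckTopology X) (bandPresheaf M N)) z 0
    (hz.trans (map_zero (toBand M N V)).symm)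
  obtain ⟨W, f, hf, hW⟩ := this y hy
  exact ⟨W, f.le, hW, hf.trans (map_zero (rst (bandPresheaf M N) f.le))⟩

lemma exists_toBand (s : (band M N).obj.obj (op V)) (y : X)
    (hy : y ∈ V) : ∃ (W : Opens X) (h : W ≤ V) (z : (bandPresheaf M N).obj (op W)), y ∈ W ∧
      toBand M N W z = rst (band M N).obj h s := by
  have h := Presheaf.imageSieve_mem (Opens.grothendieckTopology X)
    (toSheafify (Opens.grothendieckTopology X) (bandPresheaf M N)) (U := op V) s
  obtain ⟨W, f, ⟨z, hz⟩, hW⟩ := h y hy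
  exact ⟨W, f.le, z, hW, hz⟩

/-- Vanishing after sheafification is local vanishing in the presheaf, and membership in `N` is a
local condition. -/
lemma mem_of_chartClass_eq_zero (hc : IsCentralPair M N) (x : ChartOn G V) (a : x.obj ≅ x.obj)
    (ha : M.Mem a) (h0 : chartClass M N x a ha = 0) : N.Mem a := by
  have key : ∀ y ∈ V, ∃ (W : Opens X) (h : W ≤ V), y ∈ W ∧ N.Mem (PronilpotentGerbe.ris h a) := by
    intro y hy
    obtain ⟨W, h, hW, e⟩ := toBand_eq_zero (preClass M N x a ha) h0 y hy
    refine ⟨W, h, hW, ?_⟩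
    have e' := (rst_preClass M N h x a ha).symm.trans e
    exact mem_of_preClass_eq_zero hc (x.restrict (homOfLE h)) _ _ e'
  exact mem_of_locally key

end BandClass

/-! ### Classes in the band for automorphisms of arbitrary local objects -/

section AutClass

variable {X : TopCat.{u}} {G : PrestackOn.{u, w} X} [IsGerbe G] (M N : NormalSubgroupoid G)
  {V₁ V₂ V W W' : Opens X} {b : Sec G V₁} {c : Sec G V₂} {h₁ : W ≤ V₁} {h₂ : W ≤ V₂}

lemma chartClass_eq_chartClass (x y : ChartOn G W) (g : rob b h₁ ≅ x.obj) (g' : rob b h₁ ≅ y.obj)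
    (a : rob b h₁ ≅ rob b h₁) (ha : M.Mem a) :
    chartClass M N x (g.symm ≪≫ a ≪≫ g) (ha.conj g) =
      chartClass M N y (g'.symm ≪≫ a ≪≫ g') (ha.conj g') := by
  rw [← chartClass_conj M N x y (g.symm ≪≫ g')]
  congr 1
  simp

lemma exists_chart (b : Sec G V₁) (h₁ : W ≤ V₁) (y : X) (hy : y ∈ W) :
    ∃ (W' : Opens X) (_ : W' ≤ W) (x : ChartOn G W'), y ∈ W' ∧
      ∀ h : W' ≤ V₁, Nonempty (rob b h ≅ x.obj) := by
  obtain ⟨W', h, hy', e⟩ := exists_iso (W := W ⊓ chartDom G y) b (chart G y)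
    (inf_le_left.trans h₁) inf_le_right y ⟨hy, mem_chartDom G y⟩
  exact ⟨W', h.trans inf_le_left, ⟨y, h.trans inf_le_right⟩, hy', fun _ => e⟩

/-- Near each point `b` is isomorphic to a chart object. The class of the transported automorphism
does not depend on the isomorphism, thanks to the relation `ad`, so the local classes glue. -/
lemma exists_autClass (a : rob b h₁ ≅ rob b h₁) (ha : M.Mem a) :
    ∃ s : (band M N).obj.obj (op W), ∀ (W' : Opens X) (h : W' ≤ W) (x : ChartOn G W')
      (g : rob b (h.trans h₁) ≅ x.obj), rst (band M N).obj h s =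
        chartClass M N x (g.symm ≪≫ ris h a ≪≫ g) ((ha.ris h).conj g) := by
  choose D hD x hy g using fun y : W => exists_chart b h₁ y.1 y.2
  replace g (y : W) : rob b ((hD y).trans h₁) ≅ (x y).obj := (g y _).some
  -- One computation serves twice: for agreement on overlaps, comparing both sides in a common
  -- chart, and for the characterisation of the glued section in every chart.
  have hr (y : W) (W' : Opens X) (h : W' ≤ D y) (z : ChartOn G W')
      (g' : rob b ((h.trans (hD y)).trans h₁) ≅ z.obj) :
      rst (band M N).obj h (chartClass M N (x y) ((g y).symm ≪≫ ris (hD y) a ≪≫ g y)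
        ((ha.ris (hD y)).conj (g y))) =
      chartClass M N z (g'.symm ≪≫ ris (h.trans (hD y)) a ≪≫ g')
        ((ha.ris (h.trans (hD y))).conj g') := by
    rw [rst_chartClass, ← chartClass_eq_chartClass M N ((x y).restrict (homOfLE h)) z
      (ris h (g y)) g' (ris (h.trans (hD y)) a) (ha.ris _)]
    congr 1
    simp
  obtain ⟨s, hs⟩ := exists_rst_eq (band M N) D W hD
    (fun y hy' => Opens.mem_iSup.2 ⟨⟨y, hy'⟩, hy _⟩)
    (fun y => chartClass M N (x y) ((g y).symm ≪≫ ris (hD y) a ≪≫ g y)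
      ((ha.ris (hD y)).conj (g y))) (fun y z => by
        have e₁ := hr y (D y ⊓ D z) inf_le_left ((x z).restrict (homOfLE inf_le_right))
          (ris inf_le_right (g z))
        have e₂ := hr z (D y ⊓ D z) inf_le_right ((x z).restrict (homOfLE inf_le_right))
          (ris inf_le_right (g z))
        exact e₁.trans e₂.symm)
  refine ⟨s, fun W' h z g' => eq_of_rst_eq _ _ _ fun y hyW => ?_⟩
  refine ⟨W' ⊓ D ⟨y, h hyW⟩, inf_le_left, ⟨hyW, hy _⟩, ?_⟩
  have e₁ := hr ⟨y, h hyW⟩ (W' ⊓ D ⟨y, h hyW⟩) inf_le_right (z.restrict (homOfLE inf_le_left))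
    (ris inf_le_left g')
  rw [← hs, rst_rst] at e₁
  rw [rst_rst, rst_chartClass]
  refine e₁.trans ?_
  congr 1
  simp

/-- The section of the band `M / N` given by a section of `M(i, i)`. -/
def autClass (a : rob b h₁ ≅ rob b h₁) (ha : M.Mem a) : (band M N).obj.obj (op W) :=
  (exists_autClass M N a ha).choose

lemma rst_autClass_eq_chartClass (a : rob b h₁ ≅ rob b h₁) (ha : M.Mem a) (h : W' ≤ W)
    (x : ChartOn G W') (g : rob b (h.trans h₁) ≅ x.obj) :
    rst (band M N).obj h (autClass M N a ha) =
      chartClass M N x (g.symm ≪≫ ris h a ≪≫ g) ((ha.ris h).conj g) :=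
  (exists_autClass M N a ha).choose_spec W' h x g

lemma rst_autClass (h : W' ≤ W) (a : rob b h₁ ≅ rob b h₁) (ha : M.Mem a) :
    rst (band M N).obj h (autClass M N a ha) = autClass M N (ris h a) (ha.ris h) := by
  refine eq_of_rst_eq _ _ _ fun y hy => ?_
  obtain ⟨D, hD, x, hyD, g⟩ := exists_chart b (h.trans h₁) y hy
  have g := (g (hD.trans (h.trans h₁))).some
  refine ⟨D, hD, hyD, ?_⟩
  rw [rst_rst, rst_autClass_eq_chartClass _ _ _ _ _ x g,
    rst_autClass_eq_chartClass _ _ _ _ _ x g]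
  congr 1
  simp

lemma autClass_trans (a a' : rob b h₁ ≅ rob b h₁) (ha : M.Mem a) (ha' : M.Mem a') :
    autClass M N (a ≪≫ a') (ha.trans ha') = autClass M N a ha + autClass M N a' ha' := by
  refine eq_of_rst_eq _ _ _ fun y hy => ?_
  obtain ⟨D, hD, x, hyD, g⟩ := exists_chart b h₁ y hy
  have g := (g (hD.trans h₁)).some
  refine ⟨D, hD, hyD, ?_⟩
  rw [map_add, rst_autClass_eq_chartClass _ _ _ _ _ x g,
    rst_autClass_eq_chartClass _ _ _ _ _ x g, rst_autClass_eq_chartClass _ _ _ _ _ x g,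
    ← chartClass_trans]
  congr 1
  simp

lemma autClass_conj (g : rob b h₁ ≅ rob c h₂) (a : rob b h₁ ≅ rob b h₁) (ha : M.Mem a) :
    autClass M N (g.symm ≪≫ a ≪≫ g) (ha.conj g) = autClass M N a ha := by
  refine eq_of_rst_eq _ _ _ fun y hy => ?_
  obtain ⟨D, hD, x, hyD, g'⟩ := exists_chart b h₁ y hy
  have g' := (g' (hD.trans h₁)).some
  refine ⟨D, hD, hyD, ?_⟩
  rw [rst_autClass_eq_chartClass _ _ _ _ _ x g',
    rst_autClass_eq_chartClass _ _ _ _ _ x ((ris hD g).symm ≪≫ g')]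
  congr 1
  simp

variable {M N}

lemma autClass_eq_zero_iff (hc : IsCentralPair M N) (a : rob b h₁ ≅ rob b h₁) (ha : M.Mem a) :
    autClass M N a ha = 0 ↔ N.Mem a := by
  constructor
  · intro h0
    refine mem_of_locally fun y hy => ?_
    obtain ⟨D, hD, x, hyD, g⟩ := exists_chart b h₁ y hy
    have g := (g (hD.trans h₁)).some
    refine ⟨D, hD, hyD, ?_⟩
    have e := rst_autClass_eq_chartClass M N a ha hD x g
    rw [h0, map_zero] at e
    have := (mem_of_chartClass_eq_zero hc _ _ _ e.symm).conj g.symm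
    simpa using this
  · intro h0
    refine eq_of_rst_eq _ _ _ fun y hy => ?_
    obtain ⟨D, hD, x, hyD, g⟩ := exists_chart b h₁ y hy
    have g := (g (hD.trans h₁)).some
    refine ⟨D, hD, hyD, ?_⟩
    rw [rst_autClass_eq_chartClass M N a ha hD x g, map_zero]
    exact chartClass_eq_zero _ _ _ ((h0.ris hD).conj g)

lemma autClass_symm (hc : IsCentralPair M N) (a : rob b h₁ ≅ rob b h₁) (ha : M.Mem a) :
    autClass M N a.symm ha.symm = - autClass M N a ha := by
  rw [eq_neg_iff_add_eq_zero, ← autClass_trans, autClass_eq_zero_iff hc, Iso.symm_self_id]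
  exact (N.grp _).one_mem

variable (M N V) in
/-- The section of the band given by a formal combination of generators. -/
def freeClass : FreeAbelianGroup (BandGen M V) →+ (band M N).obj.obj (op V) :=
  (toBand M N V).comp (QuotientAddGroup.mk' (bandRelations M N V))

/-- After shrinking, every generator is moved to the single object `b`, where sums of classes become
compositions. -/
lemma exists_autClass_eq_freeClass (hc : IsCentralPair M N) (b : Sec G V₁)
    (z : FreeAbelianGroup (BandGen M V)) (hV : V ≤ V₁) (y : X) (hy : y ∈ V) :
    ∃ (W : Opens X) (h : W ≤ V) (a : rob b (h.trans hV) ≅ rob b (h.trans hV)) (ha : M.Mem a),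
      y ∈ W ∧ rst (band M N).obj h (freeClass M N V z) = autClass M N a ha := by
  induction z using FreeAbelianGroup.induction_on with
  | zero =>
    refine ⟨V, le_rfl, Iso.refl _, (M.grp _).one_mem, hy, ?_⟩
    rw [map_zero, map_zero]
    exact ((autClass_eq_zero_iff hc _ _).2 (N.grp _).one_mem).symm
  | of s =>
    obtain ⟨x, a, ha⟩ := s
    obtain ⟨W, h, hy', ⟨g⟩⟩ := exists_iso b (chart G x.1) hV x.2 y hy
    refine ⟨W, h, _, (Mem.ris h ha).conj g.symm, hy', ?_⟩
    refine (rst_chartClass M N h x a ha).trans ?_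
    rw [← rst_self (band M N).obj le_rfl (autClass M N _ _),
      rst_autClass_eq_chartClass _ _ _ _ le_rfl (x.restrict (homOfLE h)) g]
    congr 1
    simp
  | neg s ih =>
    obtain ⟨W, h, a, ha, hy', e⟩ := ih
    refine ⟨W, h, a.symm, ha.symm, hy', ?_⟩
    rw [autClass_symm hc a ha, ← e, map_neg, map_neg]
  | add s t hs ht =>
    obtain ⟨W, h, a, ha, hy', e⟩ := hs
    obtain ⟨W', h', a', ha', hy'', e'⟩ := ht
    refine ⟨W ⊓ W', inf_le_left.trans h, _, (ha.ris inf_le_left).trans (ha'.ris inf_le_right),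
      ⟨hy', hy''⟩, ?_⟩
    rw [autClass_trans M N _ _ (ha.ris inf_le_left) (ha'.ris inf_le_right),
      ← rst_autClass M N inf_le_left a ha, ← rst_autClass M N inf_le_right a' ha', ← e,
      ← e', rst_rst, rst_rst, map_add, map_add]

lemma exists_local_autClass (hc : IsCentralPair M N) (b : Sec G V₁) (hV : V ≤ V₁)
    (s : (band M N).obj.obj (op V)) (y : X) (hy : y ∈ V) :
    ∃ (W : Opens X) (h : W ≤ V) (a : rob b (h.trans hV) ≅ rob b (h.trans hV)) (ha : M.Mem a),
      y ∈ W ∧ rst (band M N).obj h s = autClass M N a ha := by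
  obtain ⟨D, hD, z, hyD, e⟩ := exists_toBand s y hy
  obtain ⟨z, rfl⟩ := QuotientAddGroup.mk_surjective z
  obtain ⟨W, h, a, ha, hyW, e'⟩ := exists_autClass_eq_freeClass hc b z (hD.trans hV) y hyD
  refine ⟨W, h.trans hD, a, ha, hyW, ?_⟩
  rw [← e', ← rst_rst (h := hD) (h' := h), ← e]
  rfl

end AutClass

end NormalSubgroupoid

namespace NormalSubgroupoid

/-! ### Comparison with the quotient sheaf of a single local object -/

section QuotSheaf

variable {X : TopCat.{u}} {G : PrestackOn.{u, w} X} (M N : NormalSubgroupoid G)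
  {U V W : Opens X} (i : Sec G U)

-- Equality in the associated sheaf is local equality of cosets, and `N` is a subsheaf, so the coset
-- relation descends to `V`.
variable {M N i} in
lemma mem_of_toQuot_eq (h : V ≤ U) (m n : rob i h ≅ rob i h) (hm : M.Mem m) (hn : M.Mem n)
    (hmn : M.toQuot N i (Over.mk (homOfLE h)) ⟨m, hm⟩ =
      M.toQuot N i (Over.mk (homOfLE h)) ⟨n, hn⟩) :
    N.Mem (n ≪≫ m.symm) := by
  have hs := Presheaf.equalizerSieve_mem ((Opens.grothendieckTopology X).over U)
    (toSheafify ((Opens.grothendieckTopology X).over U) (quotPresheaf M N i))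
    (X := op (Over.mk (homOfLE h))) (QuotientGroup.mk ⟨m, hm⟩) (QuotientGroup.mk ⟨n, hn⟩) hmn
  rw [GrothendieckTopology.mem_over_iff] at hs
  refine mem_of_locally fun y hy => ?_
  obtain ⟨W, f, hf, hW⟩ := hs y hy
  rw [Sieve.overEquiv_iff] at hf
  refine ⟨W, f.le, hW, ?_⟩
  have e := QuotientGroup.eq.1 hf
  rw [Subgroup.mem_subgroupOf] at e
  rw [ris_trans, ris_symm]
  have e₁ := pullAut_eq_ris (h₁ := h) f.le m
  have e₂ := pullAut_eq_ris (h₁ := h) f.le n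
  rw [← e₁, ← e₂]
  exact e

/-- The morphism of presheaves of quotients `M(i, i) / N'(i, i) → M(i, i) / N(i, i)`. -/
def quotPresheafMap {N' : NormalSubgroupoid G}
    (h : ∀ {U : Opens X} (i : Sec G U), N'.grp i ≤ N.grp i) :
    quotPresheaf M N' i ⟶ quotPresheaf M N i where
  app T := ↾(QuotientGroup.map _ _ (MonoidHom.id (M.grp (res T.unop.hom i))) fun _ hn => h _ hn)
  naturality {T T'} f := by
    ext a
    induction a using QuotientGroup.induction_on with
    | H a => rfl

variable {N} in
lemma quotSheafMap_toQuot {N' : NormalSubgroupoid G}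
    (h : ∀ {U : Opens X} (i : Sec G U), N'.grp i ≤ N.grp i) (T : Over U)
    (n : M.grp (res T.hom i)) :
    (quotSheafMap M h i).hom.app (op T) (toQuot M N' i T n) = toQuot M N i T n := by
  have := toSheafify_naturality ((Opens.grothendieckTopology X).over U) (quotPresheafMap M N i h)
  exact (ConcreteCategory.congr_hom (NatTrans.congr_app this (op T))
    (QuotientGroup.mk n)).symm

variable [IsGerbe G]

/-- The band as a sheaf of sets on `U`. -/
abbrev bandOver (U : Opens X) : Sheaf ((Opens.grothendieckTopology X).over U) (Type u) :=
  ((sheafCompose _ (forget AddCommGrpCat.{u})).obj (band M N)).over U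

variable {M N}

/-- The comparison map from `M(i, i)(V) / N(i, i)(V)` to the sections of the band. -/
def quotClass (hc : IsCentralPair M N) (h : V ≤ U) :
    M.grp (rob i h) ⧸ (N.grp (rob i h)).subgroupOf (M.grp (rob i h)) →
      (band M N).obj.obj (op V) :=
  Quotient.lift (fun n => autClass M N (b := i) n.1 n.2) fun m n hmn => by
    have e := (N.grp (rob i h)).mem_subgroupOf.1 (QuotientGroup.leftRel_apply.1 hmn)
    have e' : N.Mem ((n.1 : rob i h ≅ rob i h) ≪≫ (m.1 : rob i h ≅ rob i h).symm) := e
    have := (autClass_eq_zero_iff hc _ (Mem.trans n.2 (Mem.symm m.2))).2 e'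
    rw [autClass_trans M N _ _ n.2 (Mem.symm m.2), autClass_symm hc _ m.2, ← sub_eq_add_neg,
      sub_eq_zero] at this
    exact this.symm

/-- The comparison morphism from the presheaf `M(i, i) / N(i, i)` to the band. -/
def quotToBand (hc : IsCentralPair M N) : quotPresheaf M N i ⟶ (bandOver M N U).obj where
  app T := ↾(quotClass i hc T.unop.hom.le)
  naturality T T' f := by
    ext a
    induction a using QuotientGroup.induction_on with
    | H a =>
      have e := pullAut_eq_ris (h₁ := T.unop.hom.le) f.unop.left.le a.1
      have e' : M.pull T.unop.hom f.unop.left T'.unop.hom i a =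
          ⟨ris f.unop.left.le a.1, Mem.ris _ a.2⟩ := Subtype.ext e
      exact (congrArg (fun t => quotClass i hc T'.unop.hom.le (QuotientGroup.mk t)) e').trans
        (rst_autClass M N f.unop.left.le a.1 a.2).symm

/-- Injectivity holds before any localisation, since `autClass_eq_zero_iff` has kernel `N` over each
open set. -/
lemma quotToBand_isLocallyInjective (hc : IsCentralPair M N) :
    Presheaf.IsLocallyInjective ((Opens.grothendieckTopology X).over U) (quotToBand i hc) := by
  refine Presheaf.isLocallyInjective_of_injective _ _ fun T p q hpq => ?_
  induction p using QuotientGroup.induction_on with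
  | H p =>
  induction q using QuotientGroup.induction_on with
  | H q =>
  have hpq' : autClass M N (b := i) p.1 p.2 = autClass M N (b := i) (h₁ := T.unop.hom.le) q.1 q.2 :=
    hpq
  rw [← sub_eq_zero, sub_eq_add_neg, ← autClass_symm hc _ q.2,
    ← autClass_trans M N _ _ p.2 (Mem.symm q.2), autClass_eq_zero_iff hc] at hpq'
  refine (QuotientGroup.eq.2 ?_).symm
  rw [Subgroup.mem_subgroupOf]
  exact hpq'

lemma quotToBand_isLocallySurjective (hc : IsCentralPair M N) :
    Presheaf.IsLocallySurjective ((Opens.grothendieckTopology X).over U) (quotToBand i hc) where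
  imageSieve_mem {T} s := by
    rw [GrothendieckTopology.mem_over_iff]
    intro y hy
    obtain ⟨W, h, a, ha, hyW, e⟩ := exists_local_autClass hc i T.hom.le s y hy
    refine ⟨W, homOfLE h, ?_, hyW⟩
    rw [Sieve.overEquiv_iff]
    exact ⟨QuotientGroup.mk ⟨a, ha⟩, e.symm⟩

/-- The comparison `quotToBand` is locally bijective, so it identifies the quotient sheaf of `i`
with the band over `U`; surjectivity of `toQuot` thereby becomes surjectivity onto sections of the
band. -/
lemma exists_autClass_eq (hc : IsCentralPair M N)
    (hs : Function.Surjective (M.toQuot N i (Over.mk (𝟙 U)))) (s : (band M N).obj.obj (op U)) :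
    ∃ (a : rob i le_rfl ≅ rob i (le_refl U)) (ha : M.Mem a), autClass M N a ha = s := by
  let J := (Opens.grothendieckTopology X).over U
  have := quotToBand_isLocallyInjective i hc
  have := quotToBand_isLocallySurjective i hc
  have hW : IsIso ((presheafToSheaf J (Type u)).map (quotToBand i hc)) :=
    (J.W_iff _).1 (J.W_of_isLocallyBijective (quotToBand i hc))
  have hI : IsIso (toSheafify J (bandOver M N U).obj) :=
    isIso_toSheafify J (bandOver M N U).property
  let e := (sheafToPresheaf J (Type u)).mapIso (asIso ((presheafToSheaf J (Type u)).map
    (quotToBand i hc)))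
  let T : (Over U)ᵒᵖ := op (Over.mk (𝟙 U))
  obtain ⟨⟨a, ha⟩, hq⟩ := hs (e.inv.app T ((toSheafify J (bandOver M N U).obj).app T s))
  refine ⟨a, ha, ?_⟩
  -- The band is already a sheaf, so equality of its sections can be tested after sheafifying again.
  have hinj : Function.Injective ((toSheafify J (bandOver M N U).obj).app T) :=
    ((isIso_iff_bijective _).1 inferInstance).1
  apply hinj
  have nat := ConcreteCategory.congr_hom (NatTrans.congr_app
    (toSheafify_naturality J (quotToBand i hc)) T) (QuotientGroup.mk ⟨a, ha⟩)
  refine nat.trans ?_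
  have hq' := congrArg (e.hom.app T) hq
  refine hq'.trans ?_
  exact ConcreteCategory.congr_hom (NatTrans.congr_app e.inv_hom_id T) _

end QuotSheaf

end NormalSubgroupoid

/-! ### Central filtrations -/

section Central

variable {X : TopCat.{u}} {G : PrestackOn.{u, w} X} {N : ℕ → NormalSubgroupoid G}

lemma IsCentralFiltration.isCentralPair (hN : IsCentralFiltration N) (p : ℕ) :
    (N p).IsCentralPair (N (p + 1)) := by
  intro U i (g : Aut i) (a : Aut i) ha
  let q := QuotientGroup.mk' ((N (p + 1)).grp i)
  have h := hN.central p i (Subgroup.mem_map_of_mem q ha)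
  have e := Subgroup.mem_center_iff.1 h (q g)
  refine (QuotientGroup.eq_one_iff _).1 ?_
  change q (((a⁻¹ * g) * a) * g⁻¹) = 1
  rw [map_mul, map_mul, map_mul, map_inv, map_inv, mul_assoc (q a)⁻¹, e]
  group

lemma IsCentralFiltration.mem_zero (hN : IsCentralFiltration N) {U : Opens X} {i : Sec G U}
    (a : i ≅ i) : (N 0).Mem a := by
  change _ ∈ (N 0).grp i
  rw [hN.zero]
  trivial

lemma IsCentralFiltration.eq_refl (hN : IsCentralFiltration N) {U : Opens X} {i : Sec G U}
    (a : i ≅ i) (ha : ∀ p, (N p).Mem a) : a = Iso.refl i := by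
  have h : (show Aut i from a) ∈ ⨅ p, (N p).grp i := Subgroup.mem_iInf.2 ha
  rw [hN.iInf] at h
  exact h

/-- Completeness concerns automorphisms, so the sequence of isomorphisms is first divided by its
initial term and the limit is multiplied back. -/
lemma exists_limit (hN : IsCentralFiltration N) (hcomplete : IsComplete N hN.normal)
    {V₁ V₂ W : Opens X} {b : Sec G V₁} {c : Sec G V₂} {h₁ : W ≤ V₁} {h₂ : W ≤ V₂}
    (g : ℕ → (rob b h₁ ≅ rob c h₂)) (hg : ∀ p, (N p).Mem (g (p + 1) ≪≫ (g p).symm)) :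
    ∃ g' : rob b h₁ ≅ rob c h₂, ∀ p, (N p).Mem (g' ≪≫ (g p).symm) := by
  -- The factor `g 0` cancels in `a (p + 1) ≪≫ (a p).symm`, so consecutive terms still agree modulo
  -- `N p`.
  let a (p : ℕ) : rob b h₁ ≅ rob b h₁ := g p ≪≫ (g 0).symm
  let T : Over V₁ := Over.mk (homOfLE h₁)
  obtain ⟨a', ha', -⟩ := hcomplete b T
    (fun p => (NormalSubgroupoid.whole G).toQuot (N p) b T ⟨a p, trivial⟩) (fun p => by
      rw [NormalSubgroupoid.quotSheafMap_toQuot]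
      refine congrArg (fun t => (toSheafify ((Opens.grothendieckTopology X).over V₁)
        (((NormalSubgroupoid.whole G).quotPresheaf (N p)) b)).app (op T) t)
        (QuotientGroup.eq.2 ?_).symm
      rw [Subgroup.mem_subgroupOf]
      have e : a (p + 1) ≪≫ (a p).symm = g (p + 1) ≪≫ (g p).symm := by simp [a]
      have := hg p
      rw [← e] at this
      exact this)
  let a'' : rob b h₁ ≅ rob b h₁ := a'
  refine ⟨a'' ≪≫ g 0, fun p => ?_⟩
  have := NormalSubgroupoid.mem_of_toQuot_eq (M := NormalSubgroupoid.whole G) h₁ (a p) a''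
    trivial trivial (ha' p).symm
  simpa [a] using this

lemma IsAcyclicOpen.exists_autClass_eq [IsGerbe G] (hN : IsCentralFiltration N) {V W : Opens X}
    (hW : IsAcyclicOpen N W) (p : ℕ) (b : Sec G V) (h : W ≤ V) (s : (gr N p).obj.obj (op W)) :
    ∃ (a : rob b h ≅ rob b h) (ha : (N p).Mem a),
      NormalSubgroupoid.autClass (N p) (N (p + 1)) a ha = s := by
  obtain ⟨a, ha, e⟩ := NormalSubgroupoid.exists_autClass_eq (rob b h) (hN.isCentralPair p)
    (hW.surjective (rob b h) p (p + 1) p.le_succ) s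
  exact ⟨_, ha.conj (robTrans b h le_rfl), (NormalSubgroupoid.autClass_conj _ _ _ _ _).trans e⟩

end Central

/-! ### Correction of local isomorphisms -/

section Correction

variable {X : TopCat.{u}} {G : PrestackOn.{u, w} X} [IsGerbe G] {M N : NormalSubgroupoid G}
  {K : Type*} {V : K → Opens X} {U : Opens X}

open NormalSubgroupoid

/-- The quotients `g k ≪≫ (g l).symm` telescope, hence their classes form a 1-cocycle of the band.
-/
lemma exists_correction_one (hc : IsCentralPair M N) (hV : iSup V = U)
    (H : Subsingleton (Sheaf.H'.{u} (band M N) 1 U)) {i j : Sec G U} (hVU : ∀ k, V k ≤ U)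
    (hs : ∀ k (s : (band M N).obj.obj (op (V k))),
      ∃ (a : rob i (hVU k) ≅ rob i (hVU k)) (ha : M.Mem a), autClass M N a ha = s)
    (g : ∀ k, rob i (hVU k) ≅ rob j (hVU k))
    (hg : ∀ (k l : K) (W : Opens X) (hk : W ≤ V k) (hl : W ≤ V l),
      M.Mem (ris hk (g k) ≪≫ (ris hl (g l)).symm)) :
    ∃ g' : ∀ k, rob i (hVU k) ≅ rob j (hVU k), (∀ k, M.Mem (g' k ≪≫ (g k).symm)) ∧
      ∀ (k l : K) (W : Opens X) (hk : W ≤ V k) (hl : W ≤ V l),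
        N.Mem (ris hk (g' k) ≪≫ (ris hl (g' l)).symm) := by
  let c (k l : K) : (band M N).obj.obj (op (V k ⊓ V l)) :=
    autClass M N _ (hg k l _ inf_le_left inf_le_right)
  have hcW (k l : K) (W : Opens X) (hk : W ≤ V k) (hl : W ≤ V l) :
      rst (band M N).obj (le_inf hk hl) (c k l) = autClass M N _ (hg k l W hk hl) := by
    rw [rst_autClass]
    congr 1
    simp
  obtain ⟨β, hβ⟩ := isOneCoboundary_of_subsingleton (band M N) H hV (c := c) (by
    intro k l m W hk hl hm
    rw [hcW k m W hk hm, hcW k l W hk hl, hcW l m W hl hm, ← autClass_trans]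
    congr 1
    simp)
  -- With `c k l = β l - β k`, the corrected difference has class `β k + c k l - β l = 0`.
  choose a ha e using fun k => hs k (β k)
  refine ⟨fun k => a k ≪≫ g k, fun k => by simpa using ha k, fun k l W hk hl => ?_⟩
  have e₁ : ris hk (a k ≪≫ g k) ≪≫ (ris hl (a l ≪≫ g l)).symm =
      (ris hk (a k) ≪≫ ris hk (g k) ≪≫ (ris hl (g l)).symm) ≪≫ (ris hl (a l)).symm := by simp
  have m₁ := ((ha k).ris hk).trans (hg k l W hk hl)
  have m₂ := ((ha l).ris hl).symm
  rw [e₁, ← autClass_eq_zero_iff hc _ (m₁.trans m₂), autClass_trans M N _ _ m₁ m₂,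
    autClass_trans M N _ _ ((ha k).ris hk) (hg k l W hk hl),
    autClass_symm hc _ ((ha l).ris hl), ← hcW k l W hk hl, hβ,
    ← rst_autClass M N hk _ (ha k), ← rst_autClass M N hl _ (ha l),
    e, e, map_sub, rst_rst, rst_rst]
  abel

variable {i : ∀ k, Sec G (V k)}

/-- The 2-cochain that measures the failure of the cocycle condition. -/
def defect (g : ∀ k l, rob (i k) (inf_le_left : V k ⊓ V l ≤ V k) ≅ rob (i l) inf_le_right)
    (k l m : K) {W : Opens X} (hk : W ≤ V k) (hl : W ≤ V l) (hm : W ≤ V m) :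
    rob (i k) hk ≅ rob (i k) hk :=
  ris (le_inf hk hl) (g k l) ≪≫ ris (le_inf hl hm) (g l m) ≪≫ (ris (le_inf hk hm) (g k m)).symm

/-- The defect is an automorphism of its first object. Conjugation by `g k l` carries the defect of
`(l, m, n)` to `i k`, and classes in the band are unchanged by conjugation, so the nonabelian
identity between the four defects becomes the additive 2-cocycle condition. -/
lemma exists_correction_two (hc : IsCentralPair M N) (hV : iSup V = U)
    (H : Subsingleton (Sheaf.H'.{u} (band M N) 2 U))
    (H' : ∀ k, Subsingleton (Sheaf.H'.{u} (band M N) 1 (V k)))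
    (hs : ∀ k l (s : (band M N).obj.obj (op (V k ⊓ V l))),
      ∃ (a : rob (i k) (inf_le_left : V k ⊓ V l ≤ V k) ≅ rob (i k) inf_le_left) (ha : M.Mem a),
        autClass M N a ha = s)
    (g : ∀ k l, rob (i k) (inf_le_left : V k ⊓ V l ≤ V k) ≅ rob (i l) inf_le_right)
    (hg : ∀ (k l m : K) (W : Opens X) (hk : W ≤ V k) (hl : W ≤ V l) (hm : W ≤ V m),
      M.Mem (defect g k l m hk hl hm)) :
    ∃ g' : ∀ k l, rob (i k) (inf_le_left : V k ⊓ V l ≤ V k) ≅ rob (i l) inf_le_right,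
      (∀ k l, M.Mem (g' k l ≪≫ (g k l).symm)) ∧
      ∀ (k l m : K) (W : Opens X) (hk : W ≤ V k) (hl : W ≤ V l) (hm : W ≤ V m),
        N.Mem (defect g' k l m hk hl hm) := by
  let c (k l m : K) : (band M N).obj.obj (op (V k ⊓ V l ⊓ V m)) :=
    autClass M N _ (hg k l m _ (inf_le_left.trans inf_le_left) (inf_le_left.trans inf_le_right)
      inf_le_right)
  have hcW (k l m : K) (W : Opens X) (hk : W ≤ V k) (hl : W ≤ V l) (hm : W ≤ V m) :
      rst (band M N).obj (le_inf (le_inf hk hl) hm) (c k l m) =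
        autClass M N _ (hg k l m W hk hl hm) := by
    rw [rst_autClass]
    congr 1
    simp [defect]
  obtain ⟨β, hβ⟩ := isTwoCoboundary_of_subsingleton (band M N) H hV H' (c := c) (by
    intro k l m n W hk hl hm hn
    -- Once the defect of `(l, m, n)` is conjugated to `i k`, both sides equal `g k l ≪≫ g l m ≪≫ g
    -- m n ≪≫ (g k n).symm` on `W`.
    rw [hcW k l m W hk hl hm, hcW k m n W hk hm hn, hcW l m n W hl hm hn,
      hcW k l n W hk hl hn, ← autClass_trans,
      ← autClass_conj M N (ris (le_inf hk hl) (g k l)).symm _ (hg l m n W hl hm hn),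
      ← autClass_trans]
    congr 1
    simp [defect])
  -- The sign makes the new defect, of class `-β k l - β l m + c k l m + β k m`, vanish.
  choose a ha e using fun k l => hs k l (-β k l)
  refine ⟨fun k l => a k l ≪≫ g k l, fun k l => by simpa using ha k l,
    fun k l m W hk hl hm => ?_⟩
  have e₁ : defect (fun k l => a k l ≪≫ g k l) k l m hk hl hm =
      (ris (le_inf hk hl) (a k l) ≪≫
        ((ris (le_inf hk hl) (g k l)).symm.symm ≪≫ ris (le_inf hl hm) (a l m) ≪≫
          (ris (le_inf hk hl) (g k l)).symm)) ≪≫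
        (defect g k l m hk hl hm ≪≫ (ris (le_inf hk hm) (a k m)).symm) := by simp [defect]
  have m₁ := (ha k l).ris (le_inf hk hl)
  have m₂' := (ha l m).ris (le_inf hl hm)
  have m₂ := m₂'.conj (ris (le_inf hk hl) (g k l)).symm
  have m₃ := hg k l m W hk hl hm
  have m₄' := (ha k m).ris (le_inf hk hm)
  rw [e₁, ← autClass_eq_zero_iff hc _ ((m₁.trans m₂).trans (m₃.trans m₄'.symm)),
    autClass_trans M N _ _ (m₁.trans m₂) (m₃.trans m₄'.symm), autClass_trans M N _ _ m₁ m₂,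
    autClass_trans M N _ _ m₃ m₄'.symm, autClass_symm hc _ m₄', autClass_conj M N _ _ m₂',
    ← hcW k l m W hk hl hm, hβ, ← rst_autClass M N _ _ (ha k l),
    ← rst_autClass M N _ _ (ha l m), ← rst_autClass M N _ _ (ha k m), e, e, e]
  simp only [map_add, map_sub, map_neg, rst_rst]
  abel

end Correction

/-! ### Descent -/

section Descent

variable {X : TopCat.{u}} {G : PrestackOn.{u, w} X} [IsGerbe G] {K : Type*} {V : K → Opens X}
  {U : Opens X}

lemma ofArrows_mem (hV : iSup V = U) (hVU : ∀ k, V k ≤ U) :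
    Sieve.ofArrows V (fun k => homOfLE (hVU k)) ∈ Opens.grothendieckTopology X U := by
  intro x hx
  rw [← hV] at hx
  obtain ⟨k, hk⟩ := Opens.mem_iSup.1 hx
  exact ⟨V k, homOfLE (hVU k), Sieve.ofArrows_mk _ _ k, hk⟩

lemma nonempty_hom_of_compatible (hV : iSup V = U) (hVU : ∀ k, V k ≤ U) {i j : Sec G U}
    (g : ∀ k, rob i (hVU k) ≅ rob j (hVU k))
    (hg : ∀ (k l : K) (W : Opens X) (hk : W ≤ V k) (hl : W ≤ V l), ris hk (g k) = ris hl (g l)) :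
    Nonempty (i ⟶ j) := by
  let f (k : K) : V k ⟶ U := homOfLE (hVU k)
  exact ⟨(G.fullyFaithfulToDescentData f (ofArrows_mem hV hVU)).preimage
    (Pseudofunctor.DescentData.subtypeCompatibleHomEquiv G f
      ⟨fun k => (g k).hom, fun k l Z f₁ f₂ _ =>
        congrArg Iso.hom (hg k l Z.left f₁.left.le f₂.left.le)⟩)⟩

lemma nonempty_sec_of_cocycle (hV : iSup V = U) (hVU : ∀ k, V k ≤ U) {i : ∀ k, Sec G (V k)}
    (g : ∀ k l, rob (i k) (inf_le_left : V k ⊓ V l ≤ V k) ≅ rob (i l) inf_le_right)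
    (hg : ∀ (k l m : K) (W : Opens X) (hk : W ≤ V k) (hl : W ≤ V l) (hm : W ≤ V m),
      defect g k l m hk hl hm = Iso.refl _) : Nonempty (Sec G U) := by
  let f (k : K) : V k ⟶ U := homOfLE (hVU k)
  have hcomp (k l m : K) (W : Opens X) (hk : W ≤ V k) (hl : W ≤ V l) (hm : W ≤ V m) :
      ris (le_inf hk hl) (g k l) ≪≫ ris (le_inf hl hm) (g l m) = ris (le_inf hk hm) (g k m) := by
    have := congrArg (· ≪≫ ris (le_inf hk hm) (g k m)) (hg k l m W hk hl hm)
    simpa [defect] using this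
  let D : G.DescentData f :=
    { obj := i
      hom Y q k l f₁ f₂ _ _ := (ris (le_inf f₁.le f₂.le) (g k l)).hom
      pullHom_hom Y' Y h q q' hq k l f₁ f₂ _ _ gf₁ gf₂ _ _ :=
        congrArg Iso.hom (ris_ris (le_inf f₁.le f₂.le) h.le (g k l))
      hom_self Y q k h _ := by
        -- With three equal indices the cocycle condition says that `g k k` is idempotent; being
        -- invertible, it is the identity.
        have := hcomp k k k Y h.le h.le h.le
        have e := congrArg Iso.hom this
        rw [Iso.trans_hom] at e
        exact (cancel_epi_id _).1 e
      hom_comp Y q k l m f₁ f₂ f₃ _ _ _ :=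
        congrArg Iso.hom (hcomp k l m Y f₁.le f₂.le f₃.le) }
  have := G.isEquivalence_toDescentData f (ofArrows_mem hV hVU)
    (J := Opens.grothendieckTopology X)
  exact ⟨(G.toDescentData f).objPreimage D⟩

end Descent

/-! ### Successive approximation -/

/-- Dependent choice for states whose type varies with the stage, so that the condition modulo `N p`
is part of the state. -/
lemma exists_seq_of_step {S : ℕ → Type*} {R : ∀ p, S (p + 1) → S p → Prop} (s₀ : S 0)
    (h : ∀ p (s : S p), ∃ t, R p t s) : ∃ s : ∀ p, S p, ∀ p, R p (s (p + 1)) (s p) := by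
  choose t ht using h
  exact ⟨fun p => Nat.rec s₀ t p, fun p => ht p _⟩

/-! ### Connectedness, then nonemptiness -/

section Main

variable {X : TopCat.{u}} {G : PrestackOn.{u, w} X} [IsGerbe G] {N : ℕ → NormalSubgroupoid G}

lemma IsAcyclicFamily.single {K : Type u} {V : K → Opens X} (h : IsAcyclicFamily N V) (k : K) :
    IsAcyclicOpen N (V k) := by
  simpa using h 0 fun _ => k

lemma IsAcyclicFamily.inf {K : Type u} {V : K → Opens X} (h : IsAcyclicFamily N V) (k l : K) :
    IsAcyclicOpen N (V k ⊓ V l) := by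
  have := h 1 ![k, l]
  simpa [Fin.univ_succ] using this

variable {U : Opens X}

theorem nonempty_hom_of_subsingleton (hN : IsCentralFiltration N)
    (hcomplete : IsComplete N hN.normal) (hacyclic : HasEnoughAcyclicCoverings N)
    (H : ∀ p : ℕ, Subsingleton (Sheaf.H'.{u} (gr N p) 1 U)) (i j : Sec G U) :
    Nonempty (i ⟶ j) := by
  choose D hD hxD φ using fun x : U => exists_iso i j le_rfl le_rfl x.1 x.2
  obtain ⟨K, V, hV, href, hVac⟩ := hacyclic U U D (le_antisymm (iSup_le hD)
    fun x hx => Opens.mem_iSup.2 ⟨⟨x, hx⟩, hxD _⟩)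
  have hVU (k : K) : V k ≤ U := hV ▸ le_iSup V k
  choose r hr using href
  -- Stage `p` consists of local isomorphisms agreeing modulo `N p`. Since `N 0` is everything, any
  -- local isomorphisms form a stage `0`.
  let S (p : ℕ) : Type _ := {g : ∀ k, rob i (hVU k) ≅ rob j (hVU k) //
    ∀ (k l : K) (W : Opens X) (hk : W ≤ V k) (hl : W ≤ V l),
      (N p).Mem (ris hk (g k) ≪≫ (ris hl (g l)).symm)}
  obtain ⟨g, hg⟩ := exists_seq_of_step (S := S)
    (R := fun p t s => ∀ k, (N p).Mem (t.1 k ≪≫ (s.1 k).symm))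
    ⟨fun k => ris (hr k) (φ (r k)).some, fun _ _ _ _ _ => hN.mem_zero _⟩ (fun p s => by
      obtain ⟨g', h₁, h₂⟩ := exists_correction_one (hN.isCentralPair p) hV (H p) hVU
        (fun k => (hVac.single k).exists_autClass_eq hN p i (hVU k)) s.1 s.2
      exact ⟨⟨g', h₂⟩, h₁⟩)
  choose g' hg' using fun k => exists_limit hN hcomplete (fun p => (g p).1 k) fun p => hg p k
  refine nonempty_hom_of_compatible hV hVU g' fun k l W hk hl => ?_
  -- Modulo each `N p` the limits may be replaced by the approximations of stage `p`, which agree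
  -- there; the intersection of all `N p` is trivial.
  have e : ris hk (g' k) ≪≫ (ris hl (g' l)).symm = Iso.refl _ := hN.eq_refl _ fun p => by
    have m₁ := (hg' k p).ris hk
    have m₂ := (g p).2 k l W hk hl
    have m₃ := ((hg' l p).ris hl).symm
    simpa using (m₁.trans m₂).trans m₃
  have := congrArg (· ≪≫ ris hl (g' l)) e
  simpa using this

theorem nonempty_sec_of_subsingleton (hN : IsCentralFiltration N)
    (hcomplete : IsComplete N hN.normal) (hacyclic : HasEnoughAcyclicCoverings N)
    (H : ∀ p : ℕ, Subsingleton (Sheaf.H'.{u} (gr N p) 2 U)) : Nonempty (Sec G U) := by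
  obtain ⟨K, V, hV, -, hVac⟩ := hacyclic U PUnit (fun _ => U) ciSup_const
  have hVU (k : K) : V k ≤ U := hV ▸ le_iSup V k
  let i (k : K) : Sec G (V k) := (hVac.single k).nonempty.some
  have hiso (k l : K) :
      Nonempty (rob (i k) (inf_le_left : V k ⊓ V l ≤ V k) ≅ rob (i l) inf_le_right) := by
    -- Double overlaps are acyclic, so the first statement gives isomorphisms on the whole of `V k ⊓
    -- V l`, with no further refinement of the covering.
    obtain ⟨f⟩ := nonempty_hom_of_subsingleton hN hcomplete hacyclic
      (fun p => (hVac.inf k l).cohomology p 1 one_pos) (rob (i k) inf_le_left)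
      (rob (i l) inf_le_right)
    exact ⟨@asIso _ _ _ _ f ((IsGerbe.isGroupoid (G := G) (V k ⊓ V l)).all_isIso f)⟩
  let S (p : ℕ) : Type _ :=
    {g : ∀ k l, rob (i k) (inf_le_left : V k ⊓ V l ≤ V k) ≅ rob (i l) inf_le_right //
      ∀ (k l m : K) (W : Opens X) (hk : W ≤ V k) (hl : W ≤ V l) (hm : W ≤ V m),
        (N p).Mem (defect g k l m hk hl hm)}
  obtain ⟨g, hg⟩ := exists_seq_of_step (S := S)
    (R := fun p t s => ∀ k l, (N p).Mem (t.1 k l ≪≫ (s.1 k l).symm))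
    ⟨fun k l => (hiso k l).some, fun _ _ _ _ _ _ _ => hN.mem_zero _⟩ (fun p s => by
      obtain ⟨g', h₁, h₂⟩ := exists_correction_two (hN.isCentralPair p) hV (H p)
        (fun k => (hVac.single k).cohomology p 1 one_pos)
        (fun k l => (hVac.inf k l).exists_autClass_eq hN p (i k) inf_le_left) s.1 s.2
      exact ⟨⟨g', h₂⟩, h₁⟩)
  choose g' hg' using fun k l =>
    exists_limit hN hcomplete (fun p => (g p).1 k l) fun p => hg p k l
  refine nonempty_sec_of_cocycle hV hVU g' fun k l m W hk hl hm => hN.eq_refl _ fun p => ?_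
  -- The defect of the limit is the defect of stage `p` times three factors in `N p`, the middle one
  -- conjugated by the isomorphism of stage `p` so that all are automorphisms of `i k`.
  have m₁ := (hg' k l p).ris (le_inf hk hl)
  have m₂ := ((hg' l m p).ris (le_inf hl hm)).conj (ris (le_inf hk hl) ((g p).1 k l)).symm
  have m₃ := (g p).2 k l m W hk hl hm
  have m₄ := ((hg' k m p).ris (le_inf hk hm)).symm
  have := (m₁.trans m₂).trans (m₃.trans m₄)
  simpa [defect] using this

end Main

end

end PronilpotentGerbe

theorem mainTheorem3 {X : TopCat.{u}} (G : PronilpotentGerbe.PrestackOn.{u, w} X)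
    [PronilpotentGerbe.IsGerbe G] (N : ℕ → PronilpotentGerbe.NormalSubgroupoid G)
    (hN : PronilpotentGerbe.IsCentralFiltration N)
    (hcomplete : PronilpotentGerbe.IsComplete N hN.normal)
    (hacyclic : PronilpotentGerbe.HasEnoughAcyclicCoverings N) (U : Opens X) :
    ((∀ p : ℕ, Subsingleton (Sheaf.H'.{u} (PronilpotentGerbe.gr N p) 1 U)) →
      ∀ i j : PronilpotentGerbe.Sec G U, Nonempty (i ⟶ j)) ∧
    ((∀ p : ℕ, Subsingleton (Sheaf.H'.{u} (PronilpotentGerbe.gr N p) 2 U)) →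
      Nonempty (PronilpotentGerbe.Sec G U)) :=
  ⟨PronilpotentGerbe.nonempty_hom_of_subsingleton hN hcomplete hacyclic,
    PronilpotentGerbe.nonempty_sec_of_subsingleton hN hcomplete hacyclic⟩
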